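/- **Setting.** There are $m$ disjoint communities $C_1,\dots,C_m$ with (unknown) sizes $d_i\ge 1$, and a budget $K>m$ per round. Put $\mu_i=1/d_i$ and $K'=K-m+1$. In rounds $t=1,2,\dots$ the random realizations $\Phi_t=(\Phi_t(i,\tau))_{i\in[m],\tau\in[K]}$ are independent, all $\Phi_t(i,\tau)$ being independent and uniform on $C_i$. For an allocation $\bm k\in\mathbb{Z}_{\ge 0}^m$ let $R(\bm k,\Phi)=\sum_{i}|\{\Phi(i,1),\dots,\Phi(i,k_i)\}|$ be the number of distinct members met and $r_{\bm k}(\bm\mu)=\mathbb{E}_\Phi[R(\bm k,\Phi)]$. Let $\bm k^*$ maximize $r_{\bm k}(\bm\mu)$ over $\sum_i k_i\le K$, and for $\sum_i k_i=K$ let $\Delta_{\bm k}=r_{\bm k^*}(\bm\mu)-r_{\bm k}(\bm\mu)$. Put $\Delta^i_{\min}=\min\{\Delta_{\bm k}: \Delta_{\bm k}>0,\ k_i>1\}$ and $\Delta^i_{\max}=\max\{\Delta_{\bm k}: \Delta_{\bm k}>0,\ k_i>1\}$ ($\infty$ and $0$ if there is no such $\bm k$ with $\sum_i k_i=K$), $\Delta_{\min}=\min_i\Delta^i_{\min}$,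 $\Delta_{\max}=\max_i\Delta^i_{\max}$. **Algorithm (CLCB, non-adaptive, with full information feedback).** For each $i$ keep a number of pairs $T_i$, a number of collisions $X_i$ (both initially $0$), and the empirical mean $\hat\mu_i=X_i/T_i$ ($\hat\mu_i=0$ as long as there is no pair). In round $t$ the allocation $\bm k_t$ is computed greedily from $\hat{\bm\mu}$: start with $\bm k=0$ and, $K$ times, increase $k_i$ by one for some $i\in\operatorname{argmax}_j(1-\hat\mu_j)^{k_j}$; ties may be broken in any way (for example uniformly at random) that depends only on the past and on additional randomness independent of the coming realizations. Then $C_i$ is explored $k_{i,t}$ times for each $i$, and the members $u_1,\dots,u_{k_{i,t}}$ are met, $u_x=\Phi_t(i,x)$. With $u_0$ the last member of $C_i$ met before round $t$ (null if there is none), update $T_i\leftarrow T_i+k_{i,t}-\mathbb{1}\{t=1\}$ and $X_i\leftarrow X_i+\sum_{x=0}^{k_{i,t}-1}\mathbb{1}\{u_x=u_{x+1}\}$. **Theorem.** For every $T$, the $T$-round regret $\mathrm{Reg}_{\bm\mu}(T)=\mathbb{E}\big[\sum_{t=1}^T \big(R(\bm k^*,\Phi_t)-R(\bm k_t,\Phi_t)\big)\big]$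 of this algorithm is bounded by a constant that does not depend on $T$: $$\mathrm{Reg}_{\bm\mu}(T)\le\Big(2+\frac{2me^2K'^2(K'-1)^2}{\Delta_{\min}^2}\Big)\Delta_{\max}.$$ -/

import Mathlib

open MeasureTheory ProbabilityTheory
open scoped ENNReal

noncomputable section

namespace CommunityExploration

/-- A realization: the member `φ i τ` of community `i` (which has `d i` members) that is met in
the `τ`-th exploration of community `i`, for every item `(i, τ)` with `i ∈ [m]`, `τ ∈ [K]`. -/
abbrev Realization {m : ℕ} (d : Fin m → ℕ) (K : ℕ) : Type := (i : Fin m) → Fin K → Fin (d i)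

/-- A budget allocation `k = (k_1, …, k_m)`. -/
abbrev Allocation (m : ℕ) : Type := Fin m → ℕ

/-- The distribution of a random realization: all `Φ(i, τ)` are independent and uniform on their
communities, that is, `Φ` is uniform on the (finite) product of all communities. -/
def realizationLaw {m : ℕ} (d : Fin m → ℕ) (K : ℕ) : Measure (Realization d K) :=
  uniformOn Set.univ

/-- The members of community `i` met when it is explored `n` times (`n ≤ K`), in the order in
which they are met. -/
def met {m K : ℕ} {d : Fin m → ℕ} (φ : Realization d K) (i : Fin m) (n : ℕ) : List (Fin (d i)) :=
  ((List.finRange K).take n).map (φ i)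

/-- The reward `R(k, φ)`: the number of distinct members met. -/
def reward {m K : ℕ} {d : Fin m → ℕ} (k : Allocation m) (φ : Realization d K) : ℕ :=
  ∑ i, (met φ i (k i)).toFinset.card

/-- The expected reward `r_k(μ) = E_Φ[R(k, Φ)]`. -/
def expReward {m : ℕ} (d : Fin m → ℕ) (K : ℕ) (k : Allocation m) : ℝ :=
  ∫ φ, (reward k φ : ℝ) ∂(realizationLaw d K)

/-- `k` is an optimal budget allocation: it maximizes the expected reward among all allocations
of total at most `K`. -/
def IsOptimal {m : ℕ} (d : Fin m → ℕ) (K : ℕ) (k : Allocation m) : Prop :=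
  ∑ i, k i ≤ K ∧ ∀ k' : Allocation m, ∑ i, k' i ≤ K → expReward d K k' ≤ expReward d K k

/-- `GreedySteps μ s k`: after `s` steps, the greedy allocation procedure run with parameters `μ`
can have reached the allocation `k`. Each step gives one more exploration to an element `i` of
`argmax_j (1 - μ_j)^{k_j}`; every choice in the argmax is admitted. -/
inductive GreedySteps {m : ℕ} (μ : Fin m → ℝ) : ℕ → Allocation m → Prop
  | zero : GreedySteps μ 0 (fun _ => 0)
  | step (s : ℕ) (k : Allocation m) (i : Fin m) (hk : GreedySteps μ s k)
      (hi : ∀ j, (1 - μ j) ^ k j ≤ (1 - μ i) ^ k i) :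
      GreedySteps μ (s + 1) (Function.update k i (k i + 1))

/-- The number `∑_{x=0}^{n-1} 1{u_x = u_{x+1}}` of collisions of consecutive members, where
`u_1, …, u_n` is the list and `u_0` is a member or `none` (no member). -/
def collisions {α : Type} [DecidableEq α] : Option α → List α → ℕ
  | _, [] => 0
  | u, v :: S => (if u = some v then 1 else 0) + collisions (some v) S

/-- What the learner keeps for a community with `n` members: the number of pairs `T_i`, the number
of collisions `X_i`, and the last member met (`none` if no member was met so far). -/
structure Stats (n : ℕ) where
  /-- the number of pairs -/
  T : ℤ
  /-- the number of collisions -/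
  X : ℕ
  /-- the last member met -/
  last : Option (Fin n)

/-- The statistics of community `i` at the end of the first `t` rounds, when `φ s` and `k s` are
the realization and the allocation in the `(s + 1)`-st round. In every round the list `S_i` of met
members adds `|S_i| - 1{first round}` to `T_i`, and the collisions of consecutive members,
including the pair formed with the last member met before, to `X_i`. -/
def stats {m K : ℕ} {d : Fin m → ℕ} (φ : ℕ → Realization d K) (k : ℕ → Allocation m) (i : Fin m) :
    ℕ → Stats (d i)
  | 0 => ⟨0, 0, none⟩
  | t + 1 =>
    let st := stats φ k i t
    let S := met (φ t) i (k t i)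
    { T := st.T + (S.length : ℤ) - (if t = 0 then 1 else 0)
      X := st.X + collisions st.last S
      last := S.getLast?.or st.last }

/-- The empirical mean `X_i / T_i` at the end of the first `t` rounds; it has its initial value
`0` as long as there is no pair. -/
def empMean {m K : ℕ} {d : Fin m → ℕ} (φ : ℕ → Realization d K) (k : ℕ → Allocation m) (t : ℕ)
    (i : Fin m) : ℝ :=
  if 0 < (stats φ k i t).T then ((stats φ k i t).X : ℝ) / ((stats φ k i t).T : ℝ) else 0

/-- `Φ` and `k` are the realizations and the allocations of `T` rounds of the learning algorithm
with full information feedback (`Φ t`, `k t` belong to the `(t + 1)`-st round):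
the realization of each round has the law of a random realization and is independent of the
realizations of the earlier rounds and of the allocations chosen up to and including this round;
the allocation of each round is an output of the greedy procedure, run for `K` steps on the
empirical means of the earlier rounds. The way in which ties in the greedy procedure are broken
may depend on the past and on additional randomness. -/
structure IsRun {m : ℕ} (d : Fin m → ℕ) (K T : ℕ) {Ω : Type*} [MeasurableSpace Ω] (P : Measure Ω)
    (Φ : ℕ → Ω → Realization d K) (k : ℕ → Ω → Allocation m) : Prop where
  measurable_realization : ∀ t < T, Measurable (Φ t)
  measurable_allocation : ∀ t < T, Measurable (k t)
  law : ∀ t < T, P.map (Φ t) = realizationLaw d K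
  indep : ∀ t < T, IndepFun
    (fun ω => ((fun s : Fin t => Φ s ω), (fun s : Fin (t + 1) => k s ω))) (Φ t) P
  greedy : ∀ t < T, ∀ ω,
    GreedySteps (empMean (fun s => Φ s ω) (fun s => k s ω) t) K (k t ω)

/-- The `T`-round regret with respect to the allocation `kstar`. -/
def regret {m : ℕ} {d : Fin m → ℕ} {K : ℕ} (T : ℕ) {Ω : Type*} [MeasurableSpace Ω] (P : Measure Ω)
    (Φ : ℕ → Ω → Realization d K) (k : ℕ → Ω → Allocation m) (kstar : Allocation m) : ℝ :=
  ∫ ω, ∑ t ∈ Finset.range T, ((reward kstar (Φ t ω) : ℝ) - (reward (k t ω) (Φ t ω) : ℝ)) ∂P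

/-- The reward gap `Δ_k = r_{k*}(μ) - r_k(μ)`. -/
def gap {m : ℕ} (d : Fin m → ℕ) (K : ℕ) (kstar k : Allocation m) : ℝ :=
  expReward d K kstar - expReward d K k

/-- The actions `k` (of total exactly `K`) with `k_i > 1` and `Δ_k > 0`. -/
def badActions {m : ℕ} (d : Fin m → ℕ) (K : ℕ) (kstar : Allocation m) (i : Fin m) :
    Set (Allocation m) :=
  {k | ∑ j, k j = K ∧ 1 < k i ∧ 0 < gap d K kstar k}

/-- `Δ_min = min_i Δ^i_min`, where `Δ^i_min` is the least gap of the actions in `badActions i`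
(and `∞` if there are none). -/
def gapMin {m : ℕ} (d : Fin m → ℕ) (K : ℕ) (kstar : Allocation m) : ℝ≥0∞ :=
  ⨅ i, ⨅ k ∈ badActions d K kstar i, ENNReal.ofReal (gap d K kstar k)

/-- `Δ_max = max_i Δ^i_max`, where `Δ^i_max` is the largest gap of the actions in `badActions i`
(and `0` if there are none). -/
def gapMax {m : ℕ} (d : Fin m → ℕ) (K : ℕ) (kstar : Allocation m) : ℝ≥0∞ :=
  ⨆ i, ⨆ k ∈ badActions d K kstar i, ENNReal.ofReal (gap d K kstar k)

end CommunityExploration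

end

namespace CommunityExploration

/-! ### Greedy allocations: optimality and exchange arguments. -/

section Greedy

/-! With `x_i = 1 - 1/d_i` the expected reward is the sum over `i` and `j < k_i` of `x_i ^ j`
(`expReward_eq`). It is separable and concave, so the greedy procedure is exact for the parameters
it is given (`GreedySteps.sum_le`). Let `A = K'(K'-1)`. Parameter errors of at most `ε` change the
value of an allocation exploring every community by at most `A ε / 2`, and some optimal allocation
explores every community. Comparing it with the greedy one shows that a suboptimal round has an
explored community whose error is at least `Δ_min / A` (`GreedySteps.exists_gapMin_le`). Greedy
allocations that skip a community are treated apart: they repeat only communities with estimate `0`,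
whose error is `1/d_i`.

Given the past, each new consecutive pair in community `i` collides with probability `1/d_i`. Put `c
= Δ_min / (2A)`. For `b = c` and `b = -c`, `potential` is an exponential supermartingale of the
collision count with a further discount `exp (-c²)` per exploration. Its drift therefore telescopes:
the expected potentials, summed over the rounds that explore `i`, are at most `1 / (1 - exp (-c²))`
(`IsRun.sum_lintegral_potential_le`). An error of at least `2c` forces the two potentials to add up
to at least `exp (-c²)` (`one_le_potential_add`). It is essential here that the badly estimated
community is explored in that very round.

So the expected number of suboptimal rounds is at most `2m exp(c²) / (1 - exp(-c²)) ≤ 2m e² /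
(4c²)`, whatever `T` is, and each costs at most `Δ_max`. -/

lemma sum_update_add {m : ℕ} {M : Type*} [AddCommMonoid M] (F : Fin m → ℕ → M)
    (k : Allocation m) (i : Fin m) (v : ℕ) :
    ∑ l, F l (Function.update k i v l) + F i (k i) = ∑ l, F l (k l) + F i v := by
  rw [← Finset.add_sum_erase _ _ (Finset.mem_univ i),
    ← Finset.add_sum_erase _ (fun l => F l (k l)) (Finset.mem_univ i)]
  have : ∑ l ∈ Finset.univ.erase i, F l (Function.update k i v l)
      = ∑ l ∈ Finset.univ.erase i, F l (k l) := by
    refine Finset.sum_congr rfl fun l hl => ?_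
    rw [Function.update_of_ne (Finset.ne_of_mem_erase hl)]
  rw [this, Function.update_self]
  simp only [add_comm, add_left_comm]

lemma GreedySteps.sum_eq {m s : ℕ} {μ : Fin m → ℝ} {k : Allocation m}
    (h : GreedySteps μ s k) : ∑ i, k i = s := by
  induction h with
  | zero => simp
  | step s k i hk hi ih =>
    have := sum_update_add (fun _ n => n) k i (k i + 1)
    omega

/-- The marginal gains taken by the greedy procedure and those left are separated by a
threshold. -/
lemma GreedySteps.exists_threshold {m s : ℕ} {μ : Fin m → ℝ} {k : Allocation m}
    (h : GreedySteps μ s k) (h0 : ∀ i, 0 ≤ μ i) (h1 : ∀ i, μ i ≤ 1) :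
    ∃ θ : ℝ, ∀ i, (1 - μ i) ^ k i ≤ θ ∧ ∀ j < k i, θ ≤ (1 - μ i) ^ j := by
  induction h with
  | zero => exact ⟨1, fun i => by simp⟩
  | step s k i hk hi ih =>
    obtain ⟨θ, hθ⟩ := ih
    -- The gain just taken is the new threshold: it is maximal among the gains on offer, and it is
    -- at most the old threshold, hence at most every gain taken before.
    refine ⟨(1 - μ i) ^ k i, fun l => ?_⟩
    rcases eq_or_ne l i with rfl | hl
    · rw [Function.update_self]
      refine ⟨pow_le_pow_of_le_one (by linarith [h1 l]) (by linarith [h0 l]) (Nat.le_succ _),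
        fun j hj => pow_le_pow_of_le_one (by linarith [h1 l]) (by linarith [h0 l]) (by omega)⟩
    · rw [Function.update_of_ne hl]
      exact ⟨hi l, fun j hj => (hθ i).1.trans ((hθ l).2 j hj)⟩

lemma sum_range_sub_le_of_threshold {f : ℕ → ℝ} {θ : ℝ} {k : ℕ} (hf : Antitone f)
    (h1 : f k ≤ θ) (h2 : ∀ j < k, θ ≤ f j) (n : ℕ) :
    ∑ j ∈ Finset.range n, f j - ∑ j ∈ Finset.range k, f j ≤ θ * ((n : ℝ) - k) := by
  rcases le_total k n with h | h
  · rw [← Finset.sum_Ico_eq_sub _ h]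
    have : ∑ j ∈ Finset.Ico k n, f j ≤ ∑ _j ∈ Finset.Ico k n, θ :=
      Finset.sum_le_sum fun j hj => (hf (Finset.mem_Ico.1 hj).1).trans h1
    rw [Finset.sum_const, Nat.card_Ico, nsmul_eq_mul, Nat.cast_sub h] at this
    linarith
  · rw [← neg_sub, ← Finset.sum_Ico_eq_sub _ h]
    have : ∑ _j ∈ Finset.Ico n k, θ ≤ ∑ j ∈ Finset.Ico n k, f j :=
      Finset.sum_le_sum fun j hj => h2 j (Finset.mem_Ico.1 hj).2
    rw [Finset.sum_const, Nat.card_Ico, nsmul_eq_mul, Nat.cast_sub h] at this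
    linarith

/-- The greedy procedure maximizes the separable concave objective it is run on. -/
lemma GreedySteps.sum_le {m s : ℕ} {μ : Fin m → ℝ} {k : Allocation m}
    (h : GreedySteps μ s k) (h0 : ∀ i, 0 ≤ μ i) (h1 : ∀ i, μ i ≤ 1)
    (k' : Allocation m) (hk' : ∑ i, k' i = s) :
    ∑ i, ∑ j ∈ Finset.range (k' i), (1 - μ i) ^ j
      ≤ ∑ i, ∑ j ∈ Finset.range (k i), (1 - μ i) ^ j := by
  obtain ⟨θ, hθ⟩ := h.exists_threshold h0 h1
  have key : ∑ i, (∑ j ∈ Finset.range (k' i), (1 - μ i) ^ j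
      - ∑ j ∈ Finset.range (k i), (1 - μ i) ^ j) ≤ ∑ i, θ * ((k' i : ℝ) - k i) :=
    Finset.sum_le_sum fun i _ => sum_range_sub_le_of_threshold
      (pow_right_anti₀ (by linarith [h1 i]) (by linarith [h0 i])) (hθ i).1 (hθ i).2 _
  have e : ∑ i, (k' i : ℝ) = ∑ i, (k i : ℝ) := by
    rw [← Nat.cast_sum, ← Nat.cast_sum, hk', h.sum_eq]
  rw [← Finset.mul_sum, Finset.sum_sub_distrib, Finset.sum_sub_distrib, e] at key
  linarith

/-- If the greedy procedure leaves a community unexplored, it explores only communities with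
parameter `0` more than once. -/
lemma GreedySteps.eq_zero_of_one_lt {m s : ℕ} {μ : Fin m → ℝ} {k : Allocation m}
    (h : GreedySteps μ s k) (h0 : ∀ i, 0 ≤ μ i) (h1 : ∀ i, μ i ≤ 1) {z : Fin m} (hz : k z = 0)
    {i : Fin m} (hi : 1 < k i) : μ i = 0 := by
  induction h with
  | zero => simp at hi
  | step s k l hk hl ih =>
    have hzl : z ≠ l := by
      rintro rfl
      simp at hz
    rw [Function.update_of_ne hzl] at hz
    rcases eq_or_ne i l with rfl | hil
    · rw [Function.update_self] at hi
      -- The unexplored `z` offers the gain `1`, so the second or later exploration of `i` must gain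
      -- at least `1` too.
      have h2 := hl z
      rw [hz, pow_zero] at h2
      have h3 : (1 - μ i) ^ k i ≤ (1 - μ i) ^ 1 :=
        pow_le_pow_of_le_one (by linarith [h1 i]) (by linarith [h0 i]) (by omega)
      rw [pow_one] at h3
      linarith [h0 i]
    · rw [Function.update_of_ne hil] at hi
      exact ih hz hi

lemma exists_one_lt_of_lt_sum {m : ℕ} {k : Allocation m} (h : m < ∑ i, k i) : ∃ i, 1 < k i := by
  by_contra! hc
  have : ∑ i, k i ≤ ∑ _i : Fin m, 1 := Finset.sum_le_sum fun i _ => hc i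
  simp at this
  omega

lemma exists_one_lt_of_eq_zero {m : ℕ} {k : Allocation m} (h : m ≤ ∑ i, k i) {z : Fin m}
    (hz : k z = 0) : ∃ i, 1 < k i := by
  by_contra! hc
  have : ∑ i, k i < ∑ _i : Fin m, 1 :=
    Finset.sum_lt_sum (fun i _ => hc i) ⟨z, Finset.mem_univ _, by omega⟩
  simp at this
  omega

/-- Moving explorations to unexplored communities does not decrease the reward. -/
lemma exists_pos_allocation {m : ℕ} (x : Fin m → ℝ) (hx0 : ∀ i, 0 ≤ x i) (hx1 : ∀ i, x i ≤ 1)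
    (k : Allocation m) (h : m ≤ ∑ i, k i) :
    ∃ k' : Allocation m, ∑ i, k' i = ∑ i, k i ∧ (∀ i, 1 ≤ k' i) ∧ (∀ i, k' i ≤ max (k i) 1) ∧
      ∑ i, ∑ j ∈ Finset.range (k i), x i ^ j ≤ ∑ i, ∑ j ∈ Finset.range (k' i), x i ^ j := by
  induction hn : (Finset.univ.filter fun i => k i = 0).card generalizing k with
  | zero =>
    refine ⟨k, rfl, fun i => ?_, fun i => le_max_left _ _, le_rfl⟩
    rw [Finset.card_eq_zero, Finset.filter_eq_empty_iff] at hn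
    exact Nat.one_le_iff_ne_zero.2 (hn (Finset.mem_univ i))
  | succ n ih =>
    obtain ⟨z, hz⟩ := Finset.card_pos.1 (by omega :
      0 < (Finset.univ.filter fun i => k i = 0).card)
    have hz0 : k z = 0 := (Finset.mem_filter.1 hz).2
    obtain ⟨j, hj⟩ := exists_one_lt_of_eq_zero h hz0
    have hjz : j ≠ z := by rintro rfl; omega
    -- One exploration moves from `j` to `z`: a gain `x j ^ a ≤ 1` is exchanged for `x z ^ 0 = 1`.
    set k₁ := Function.update (Function.update k j (k j - 1)) z 1 with hk₁
    have hz' : Function.update k j (k j - 1) z = 0 := by rw [Function.update_of_ne hjz.symm, hz0]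
    have e (F : Fin m → ℕ → ℝ) : ∑ i, F i (k₁ i) + F z 0 + F j (k j)
        = ∑ i, F i (k i) + F j (k j - 1) + F z 1 := by
      have e1 := sum_update_add F (Function.update k j (k j - 1)) z 1
      have e2 := sum_update_add F k j (k j - 1)
      rw [hz', ← hk₁] at e1
      linarith
    have es : ∑ i, k₁ i = ∑ i, k i := by
      have e1 := sum_update_add (fun _ n => n) (Function.update k j (k j - 1)) z 1
      have e2 := sum_update_add (fun _ n => n) k j (k j - 1)
      rw [hz', ← hk₁] at e1
      omega
    have hval (i : Fin m) : k₁ i = if i = z then 1 else if i = j then k j - 1 else k i := by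
      simp only [hk₁, Function.update_apply]
    obtain ⟨k', h1, h2, h3, h4⟩ := ih k₁ (by omega) (by
      have : (Finset.univ.filter fun i => k₁ i = 0)
          = (Finset.univ.filter fun i => k i = 0).erase z := by
        ext i
        simp only [Finset.mem_filter, Finset.mem_univ, true_and, Finset.mem_erase, hval]
        split_ifs with h1 h2
        · simp [h1]
        · subst h2; simp; omega
        · simp [h1]
      rw [this, Finset.card_erase_of_mem hz]
      omega)
    refine ⟨k', h1.trans es, h2, fun i => (h3 i).trans ?_, le_trans ?_ h4⟩
    · rw [hval]
      split_ifs with h1 h2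
      · simp
      · subst h2; omega
      · exact le_rfl
    · have e3 := e (fun i n => ∑ l ∈ Finset.range n, x i ^ l)
      obtain ⟨a, ha⟩ : ∃ a, k j = a + 1 := ⟨k j - 1, by omega⟩
      simp only [ha, Nat.add_sub_cancel, Finset.sum_range_succ, Finset.sum_range_zero,
        Finset.range_one, Finset.sum_singleton, pow_zero] at e3
      have : x j ^ a ≤ 1 := pow_le_one₀ (hx0 j) (hx1 j)
      linarith

lemma exists_le_sum_eq {m : ℕ} (i : Fin m) (k : Allocation m) {K : ℕ} (h : ∑ i, k i ≤ K) :
    ∃ k' : Allocation m, ∑ i, k' i = K ∧ ∀ i, k i ≤ k' i := by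
  refine ⟨Function.update k i (k i + (K - ∑ i, k i)), ?_, fun l => ?_⟩
  · have := sum_update_add (fun _ n => n) k i (k i + (K - ∑ i, k i))
    simp only at this
    omega
  · rw [Function.update_apply]
    split_ifs with hl
    · subst hl; omega
    · exact le_rfl

end Greedy

/-! ### Lipschitz dependence of the reward on the parameters. -/

section Lipschitz

lemma abs_pow_sub_pow_le_mul {x y : ℝ} (hx0 : 0 ≤ x) (hx1 : x ≤ 1) (hy0 : 0 ≤ y) (hy1 : y ≤ 1)
    (j : ℕ) : |x ^ j - y ^ j| ≤ j * |x - y| := by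
  have h := abs_pow_sub_pow_le x y j
  have hm : max |x| |y| ≤ 1 := by
    rw [abs_of_nonneg hx0, abs_of_nonneg hy0]
    exact max_le hx1 hy1
  have h1 : max |x| |y| ^ (j - 1) ≤ 1 := pow_le_one₀ (le_max_of_le_left (abs_nonneg x)) hm
  calc _ ≤ _ := h
    _ ≤ |x - y| * j * 1 := by gcongr
    _ = _ := by ring

lemma abs_sum_pow_sub_le {x y : ℝ} (hx0 : 0 ≤ x) (hx1 : x ≤ 1) (hy0 : 0 ≤ y) (hy1 : y ≤ 1)
    (n : ℕ) : |∑ j ∈ Finset.range n, x ^ j - ∑ j ∈ Finset.range n, y ^ j|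
      ≤ n * (n - 1) / 2 * |x - y| := by
  rw [← Finset.sum_sub_distrib]
  refine (Finset.abs_sum_le_sum_abs _ _).trans ?_
  refine (Finset.sum_le_sum fun j _ => abs_pow_sub_pow_le_mul hx0 hx1 hy0 hy1 j).trans ?_
  rw [← Finset.sum_mul]
  refine le_of_eq (congrArg (· * |x - y|) ?_)
  induction n with
  | zero => simp
  | succ n ih => rw [Finset.sum_range_succ, ih]; push_cast; ring

lemma le_of_forall_one_le {m K : ℕ} {k : Allocation m} (hs : ∑ i, k i = K) (h1 : ∀ i, 1 ≤ k i)
    (i : Fin m) : k i + m ≤ K + 1 := by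
  have h : ∑ _l ∈ Finset.univ.erase i, 1 ≤ ∑ l ∈ Finset.univ.erase i, k l :=
    Finset.sum_le_sum fun l _ => h1 l
  have h' := Finset.add_sum_erase Finset.univ k (Finset.mem_univ i)
  simp only [Finset.sum_const, Finset.card_erase_of_mem (Finset.mem_univ i), Finset.card_univ,
    Fintype.card_fin, smul_eq_mul, mul_one] at h
  omega

/-- Since every community is explored, `k i ≤ K'` and the excesses `k i - 1` add up to `K' - 1`.
This is what yields `K'` instead of `K` in the final bound. -/
lemma sum_choose_two_mul_le {m K : ℕ} (hK : m < K) {k : Allocation m} (hs : ∑ i, k i = K)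
    (h1 : ∀ i, 1 ≤ k i) {c : Fin m → ℝ} {B : ℝ} (hB : 0 ≤ B) (hc : ∀ i, 1 < k i → c i ≤ B) :
    ∑ i, (k i : ℝ) * (k i - 1) / 2 * c i
      ≤ ((K - m + 1 : ℕ) : ℝ) * ((K - m : ℕ) : ℝ) / 2 * B := by
  have h2 (i : Fin m) : (k i : ℝ) * (k i - 1) / 2 * c i
      ≤ ((k i : ℝ) - 1) * (((K - m + 1 : ℕ) : ℝ) / 2 * B) := by
    rcases (h1 i).eq_or_lt with h | h
    · simp [← h]
    · have a : (k i : ℝ) ≤ ((K - m + 1 : ℕ) : ℝ) := by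
        exact_mod_cast (by have := le_of_forall_one_le hs h1 i; omega : k i ≤ K - m + 1)
      have b : (1 : ℝ) ≤ k i := by exact_mod_cast h1 i
      calc (k i : ℝ) * (k i - 1) / 2 * c i ≤ (k i : ℝ) * (k i - 1) / 2 * B := by
            refine mul_le_mul_of_nonneg_left (hc i h) ?_
            have : (0 : ℝ) ≤ k i - 1 := by linarith
            positivity
        _ = ((k i : ℝ) - 1) * ((k i : ℝ) / 2 * B) := by ring
        _ ≤ _ := by
            refine mul_le_mul_of_nonneg_left ?_ (by linarith)
            gcongr
  refine (Finset.sum_le_sum fun i _ => h2 i).trans (le_of_eq ?_)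
  rw [← Finset.sum_mul, Finset.sum_sub_distrib, ← Nat.cast_sum, hs, Nat.cast_sub hK.le]
  simp
  ring

end Lipschitz

/-! ### Marginals of the uniform law. -/

section UniformLaw

lemma uniformOn_univ_singleton {α : Type*} [MeasurableSpace α] [MeasurableSingletonClass α]
    [Fintype α] (a : α) : uniformOn (Set.univ : Set α) {a} = (Fintype.card α : ℝ≥0∞)⁻¹ := by
  rw [uniformOn_univ, Measure.count_singleton, one_div]

lemma isProbabilityMeasure_realizationLaw {m K : ℕ} {d : Fin m → ℕ} (hd : ∀ i, 1 ≤ d i) :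
    IsProbabilityMeasure (realizationLaw d K) :=
  isProbabilityMeasure_uniformOn Set.finite_univ ⟨fun i _ => ⟨0, hd i⟩, trivial⟩

lemma map_eval_realizationLaw {m K : ℕ} {d : Fin m → ℕ} (hd : ∀ i, 1 ≤ d i) (i : Fin m) :
    (realizationLaw d K).map (fun φ => φ i) = uniformOn Set.univ := by
  have hp (i : Fin m) : IsProbabilityMeasure (uniformOn (Set.univ : Set (Fin K → Fin (d i)))) :=
    isProbabilityMeasure_uniformOn Set.finite_univ ⟨fun _ => ⟨0, hd i⟩, trivial⟩
  have h : realizationLaw d K = Measure.pi fun i => uniformOn (Set.univ : Set (Fin K → Fin (d i))) := by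
    refine Measure.ext_of_singleton fun φ => ?_
    rw [realizationLaw, Measure.pi_singleton, uniformOn_univ_singleton, Fintype.card_pi]
    simp_rw [uniformOn_univ_singleton]
    rw [← ENNReal.prod_inv_distrib, Nat.cast_prod]
    exact fun _ _ _ _ _ => Or.inr (ENNReal.natCast_ne_top _)
  rw [h]
  exact (measurePreserving_eval _ i).map_eq

lemma integral_realizationLaw_eval {m K : ℕ} {d : Fin m → ℕ} (hd : ∀ i, 1 ≤ d i) (i : Fin m)
    (f : (Fin K → Fin (d i)) → ℝ) :
    ∫ φ, f (φ i) ∂(realizationLaw d K) = (∑ g, f g) / (d i : ℝ) ^ K := by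
  have hp : IsProbabilityMeasure (uniformOn (Set.univ : Set (Fin K → Fin (d i)))) :=
    isProbabilityMeasure_uniformOn Set.finite_univ ⟨fun _ => ⟨0, hd i⟩, trivial⟩
  rw [← integral_map (φ := fun φ : Realization d K => φ i) (Measurable.of_discrete).aemeasurable
    (Measurable.of_discrete (f := f)).aestronglyMeasurable, map_eval_realizationLaw hd i,
    integral_fintype (.of_finite)]
  simp [measureReal_def, uniformOn_univ_singleton, ← Finset.mul_sum, div_eq_inv_mul]

end UniformLaw

/-! ### Counting the meeting sequences of one community. -/

section SingleCommunity

lemma sum_fin_succ_fun {n K : ℕ} (F : (Fin (K + 1) → Fin n) → ℝ) :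
    ∑ g, F g = ∑ a : Fin n, ∑ g : Fin K → Fin n, F (Fin.cons a g) := by
  rw [← (Fin.consEquiv fun _ => Fin n).sum_comp, Fintype.sum_prod_type]
  rfl

lemma take_finRange_map_cons {n K l : ℕ} (a : Fin n) (g : Fin K → Fin n) :
    ((List.finRange (K + 1)).take (l + 1)).map (Fin.cons a g : Fin (K + 1) → Fin n)
      = a :: ((List.finRange K).take l).map g := by
  rw [List.finRange_succ, List.take_succ_cons, List.map_cons, List.map_take, List.map_map,
    ← List.map_take]
  rfl

/-- Whatever the previous member is, exactly one of the `n` choices of the next one collides, so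
each of the `l` meetings contributes a factor `n - 1 + exp c`. The `K - l` unused items are free. -/
lemma sum_exp_collisions {n : ℕ} (c : ℝ) (K : ℕ) :
    ∀ l ≤ K, ∀ u : Fin n,
    ∑ g : Fin K → Fin n, Real.exp (c * collisions (some u) (((List.finRange K).take l).map g))
      = (n - 1 + Real.exp c) ^ l * n ^ (K - l) := by
  induction K with
  | zero =>
    intro l hl u
    obtain rfl : l = 0 := by omega
    simp [collisions]
  | succ K ih =>
    intro l hl u
    cases l with
    | zero => simp [collisions]
    | succ l =>
      rw [sum_fin_succ_fun]
      simp only [take_finRange_map_cons, collisions, Nat.cast_add, mul_add, Real.exp_add,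
        ← Finset.mul_sum, ih l (by omega)]
      rw [← Finset.sum_mul]
      have : ∑ a : Fin n, Real.exp (c * ((if some u = some a then 1 else 0 : ℕ) : ℝ))
          = n - 1 + Real.exp c := by
        have h (a : Fin n) : Real.exp (c * ((if some u = some a then 1 else 0 : ℕ) : ℝ))
            = 1 + if u = a then Real.exp c - 1 else 0 := by
          by_cases h : u = a <;> simp [h]
        simp_rw [h, Finset.sum_add_distrib]
        simp
        ring
      rw [this, Nat.add_sub_add_right]
      ring

/-- The first member forms no pair, hence `l` factors for `l + 1` meetings. -/
lemma sum_exp_collisions_none {n : ℕ} (c : ℝ) {K l : ℕ} (hl : l + 1 ≤ K) :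
    ∑ g : Fin K → Fin n, Real.exp (c * collisions none (((List.finRange K).take (l + 1)).map g))
      = (n - 1 + Real.exp c) ^ l * n ^ (K - l) := by
  obtain ⟨K, rfl⟩ : ∃ K', K = K' + 1 := ⟨K - 1, by omega⟩
  rw [sum_fin_succ_fun]
  simp only [take_finRange_map_cons, collisions, reduceCtorEq, if_false, zero_add,
    sum_exp_collisions c K l (by omega)]
  rw [Finset.sum_const, Finset.card_univ, Fintype.card_fin, nsmul_eq_mul,
    Nat.succ_sub (by omega : l ≤ K), pow_succ]
  ring

lemma sum_notMem {n : ℕ} (v : Fin n) (K : ℕ) :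
    ∀ l ≤ K, ∑ g : Fin K → Fin n, (if v ∈ ((List.finRange K).take l).map g then 0 else 1 : ℝ)
      = (n - 1) ^ l * n ^ (K - l) := by
  induction K with
  | zero =>
    intro l hl
    obtain rfl : l = 0 := by omega
    simp
  | succ K ih =>
    intro l hl
    cases l with
    | zero => simp
    | succ l =>
      rw [sum_fin_succ_fun]
      have h (a : Fin n) (g : Fin K → Fin n) :
          (if v ∈ a :: ((List.finRange K).take l).map g then 0 else 1 : ℝ)
            = (if v = a then 0 else 1)
              * if v ∈ ((List.finRange K).take l).map g then 0 else 1 := by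
        by_cases h : v = a
        · simp [h]
        · rw [if_neg h, one_mul]
          exact if_congr (by rw [List.mem_cons, or_iff_right h]) rfl rfl
      simp only [take_finRange_map_cons, h, ← Finset.mul_sum, ih l (by omega)]
      rw [← Finset.sum_mul]
      have : ∑ a : Fin n, (if v = a then 0 else 1 : ℝ) = n - 1 := by
        have h (a : Fin n) : (if v = a then 0 else 1 : ℝ) = 1 - if v = a then 1 else 0 := by
          split_ifs <;> simp
        simp_rw [h, Finset.sum_sub_distrib]
        simp
      rw [this, Nat.add_sub_add_right]
      ring

lemma card_toFinset_eq {n : ℕ} (S : List (Fin n)) :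
    (S.toFinset.card : ℝ) = n - ∑ v, if v ∈ S then 0 else 1 := by
  have h (v : Fin n) : (if v ∈ S then 0 else 1 : ℝ) = 1 - if v ∈ S.toFinset then 1 else 0 := by
    by_cases hv : v ∈ S <;> simp [hv]
  simp_rw [h, Finset.sum_sub_distrib]
  rw [Finset.sum_boole, Finset.filter_univ_mem]
  simp

lemma sum_card_toFinset {n : ℕ} (hn : 1 ≤ n) {K l : ℕ} (hl : l ≤ K) :
    (∑ g : Fin K → Fin n, ((((List.finRange K).take l).map g).toFinset.card : ℝ)) / n ^ K
      = ∑ j ∈ Finset.range l, (1 - 1 / (n : ℝ)) ^ j := by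
  simp_rw [card_toFinset_eq, Finset.sum_sub_distrib]
  rw [Finset.sum_comm]
  simp_rw [sum_notMem _ K l hl]
  have h0 : (n : ℝ) ≠ 0 := by positivity
  have h1 : (1 - 1 / (n : ℝ)) ≠ 1 := by simp [h0]
  rw [geom_sum_eq h1]
  have e1 : (1 - 1 / (n : ℝ)) = (n - 1) / n := by field_simp
  have e2 : (n : ℝ) ^ K = n ^ l * n ^ (K - l) := by rw [← pow_add]; congr 1; omega
  have e3 : (n - 1 : ℝ) / n - 1 = - (1 / n) := by field_simp; ring
  rw [e1, e3, div_pow]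
  simp only [Finset.sum_const, Finset.card_univ, Fintype.card_fin, Fintype.card_pi,
    Finset.prod_const, nsmul_eq_mul, Nat.cast_pow]
  rw [e2]
  field_simp
  ring

end SingleCommunity

/-! ### Closed form of the expected reward, and the exponential moment of the collisions. -/

section Reward

lemma expReward_eq {m K : ℕ} {d : Fin m → ℕ} (hd : ∀ i, 1 ≤ d i) {k : Allocation m}
    (hk : ∀ i, k i ≤ K) :
    expReward d K k = ∑ i, ∑ j ∈ Finset.range (k i), (1 - 1 / (d i : ℝ)) ^ j := by
  have := isProbabilityMeasure_realizationLaw (K := K) hd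
  simp only [expReward, reward, Nat.cast_sum]
  rw [integral_finsetSum _ fun i _ => .of_finite]
  refine Finset.sum_congr rfl fun i _ => ?_
  rw [← sum_card_toFinset (hd i) (hk i)]
  exact integral_realizationLaw_eval hd i
    fun g => ((((List.finRange K).take (k i)).map g).toFinset.card : ℝ)

lemma le_of_sum_le {m K : ℕ} {k : Allocation m} (h : ∑ i, k i ≤ K) (i : Fin m) : k i ≤ K :=
  (Finset.single_le_sum (fun _ _ => Nat.zero_le _) (Finset.mem_univ i)).trans h

/-- The expected factor by which the exponential moment of the collisions grows in a round. -/
lemma lintegral_exp_collisions_le {m K : ℕ} {d : Fin m → ℕ} (hd : ∀ i, 1 ≤ d i) (i : Fin m)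
    {c : ℝ} (hc : |c| ≤ 1) {l : ℕ} (hl : l ≤ K) (u : Option (Fin (d i))) :
    ∫⁻ φ, ENNReal.ofReal (Real.exp (c * collisions u (met φ i l))) ∂(realizationLaw d K)
      ≤ ENNReal.ofReal
          (Real.exp ((c / d i + c ^ 2) * (if u = none then l - 1 else l : ℕ))) := by
  have := isProbabilityMeasure_realizationLaw (K := K) hd
  rw [← ofReal_integral_eq_lintegral_ofReal .of_finite (.of_forall fun _ => (Real.exp_pos _).le)]
  refine ENNReal.ofReal_le_ofReal ?_
  rw [show ∫ φ, Real.exp (c * collisions u (met φ i l)) ∂(realizationLaw d K) = _ from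
    integral_realizationLaw_eval hd i
      fun g => Real.exp (c * collisions u (((List.finRange K).take l).map g))]
  have hdi : (1 : ℝ) ≤ d i := by exact_mod_cast hd i
  have hd0 : (0 : ℝ) < d i := by linarith
  -- From `exp c ≤ 1 + c + c²` for `|c| ≤ 1`, then `1 + y ≤ exp y`.
  have hbase : ((d i : ℝ) - 1 + Real.exp c) / d i ≤ Real.exp (c / d i + c ^ 2) := by
    have h1 : Real.exp c ≤ 1 + c + c ^ 2 := by
      have := (abs_le.1 (Real.abs_exp_sub_one_sub_id_le hc)).2
      linarith
    have h2 : ((d i : ℝ) - 1 + Real.exp c) / d i ≤ 1 + c / d i + c ^ 2 := by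
      rw [div_le_iff₀ hd0]
      have : (1 + c / d i + c ^ 2) * d i = d i + c + c ^ 2 * d i := by field_simp
      rw [this]
      nlinarith [sq_nonneg c]
    have := Real.add_one_le_exp (c / d i + c ^ 2)
    linarith
  have key (l' : ℕ) (h : l' ≤ K) : ((d i : ℝ) - 1 + Real.exp c) ^ l' * (d i : ℝ) ^ (K - l')
      / (d i : ℝ) ^ K ≤ Real.exp ((c / d i + c ^ 2) * l') := by
    have e : ((d i : ℝ) - 1 + Real.exp c) ^ l' * (d i : ℝ) ^ (K - l') / (d i : ℝ) ^ K
        = (((d i : ℝ) - 1 + Real.exp c) / d i) ^ l' := by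
      rw [div_pow, div_eq_div_iff (by positivity) (by positivity), mul_assoc, ← pow_add,
        Nat.sub_add_cancel h]
    rw [e, mul_comm _ (l' : ℝ), Real.exp_nat_mul]
    refine pow_le_pow_left₀ (div_nonneg ?_ hd0.le) hbase _
    linarith [Real.exp_pos c]
  cases u with
  | some u =>
    rw [sum_exp_collisions c K l hl u]
    simpa using key l hl
  | none =>
    cases l with
    | zero => simp [collisions, hd0.ne']
    | succ l =>
      rw [sum_exp_collisions_none c hl]
      simpa using key l (by omega)

end Reward

/-! ### From suboptimality to estimation error. -/

section Gap

variable {m K : ℕ} {d : Fin m → ℕ} {kstar : Allocation m}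

lemma gap_nonneg (hstar : IsOptimal d K kstar) {k : Allocation m} (hk : ∑ i, k i = K) :
    0 ≤ gap d K kstar k :=
  sub_nonneg.2 (hstar.2 k hk.le)

/-- As `m < K`, an allocation of the whole budget explores some community twice, so every suboptimal
one is counted in some `badActions`. -/
lemma gapMin_le (hK : m < K) {k : Allocation m} (hk : ∑ i, k i = K)
    (hg : 0 < gap d K kstar k) : gapMin d K kstar ≤ ENNReal.ofReal (gap d K kstar k) := by
  obtain ⟨i, hi⟩ := exists_one_lt_of_lt_sum (hk.symm ▸ hK)
  exact (iInf_le _ i).trans (iInf₂_le (f := fun k _ => ENNReal.ofReal (gap d K kstar k)) k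
    ⟨hk, hi, hg⟩)

lemma le_gapMax (hK : m < K) {k : Allocation m} (hk : ∑ i, k i = K)
    (hg : 0 < gap d K kstar k) : ENNReal.ofReal (gap d K kstar k) ≤ gapMax d K kstar := by
  obtain ⟨i, hi⟩ := exists_one_lt_of_lt_sum (hk.symm ▸ hK)
  exact (le_iSup₂ (f := fun k _ => ENNReal.ofReal (gap d K kstar k)) k
    ⟨hk, hi, hg⟩).trans (le_iSup (fun i => ⨆ k ∈ badActions d K kstar i,
      ENNReal.ofReal (gap d K kstar k)) i)

lemma one_sub_inv_nonneg (hd : ∀ i, 1 ≤ d i) (i : Fin m) : 0 ≤ 1 - 1 / (d i : ℝ) := by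
  have : (1 : ℝ) ≤ d i := by exact_mod_cast hd i
  rw [sub_nonneg, div_le_one (by linarith)]
  exact this

lemma one_sub_inv_lt_one (hd : ∀ i, 1 ≤ d i) (i : Fin m) : 1 - 1 / (d i : ℝ) < 1 := by
  have : (1 : ℝ) ≤ d i := by exact_mod_cast hd i
  have : 0 < 1 / (d i : ℝ) := by positivity
  linarith

lemma expReward_le_sum (hd : ∀ i, 1 ≤ d i) {k : Allocation m} (hk : ∑ i, k i ≤ K) :
    expReward d K k ≤ K := by
  rw [expReward_eq hd (le_of_sum_le hk)]
  calc _ ≤ ∑ i, ∑ _j ∈ Finset.range (k i), (1 : ℝ) :=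
        Finset.sum_le_sum fun i _ => Finset.sum_le_sum fun j _ =>
          pow_le_one₀ (one_sub_inv_nonneg hd i) (one_sub_inv_lt_one hd i).le
    _ ≤ K := by
        simp only [Finset.sum_const, Finset.card_range, nsmul_eq_mul, mul_one]
        exact_mod_cast hk

/-- Some allocation of the whole budget explores every community and is optimal. -/
lemma exists_optimal_pos (hK : m < K) (hd : ∀ i, 1 ≤ d i) (hstar : IsOptimal d K kstar)
    (i₀ : Fin m) : ∃ k' : Allocation m, ∑ i, k' i = K ∧ (∀ i, 1 ≤ k' i) ∧
      expReward d K kstar ≤ expReward d K k' := by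
  obtain ⟨k₁, h1, h2⟩ := exists_le_sum_eq i₀ kstar hstar.1
  obtain ⟨k', h3, h4, -, h5⟩ := exists_pos_allocation (fun i => 1 - 1 / (d i : ℝ))
    (one_sub_inv_nonneg hd) (fun i => (one_sub_inv_lt_one hd i).le) k₁ (by omega)
  refine ⟨k', h3.trans h1, h4, le_trans ?_ (h5.trans_eq
    (expReward_eq hd (le_of_sum_le (h3.trans h1).le)).symm)⟩
  rw [expReward_eq hd (le_of_sum_le hstar.1)]
  exact Finset.sum_le_sum fun i _ => Finset.sum_le_sum_of_subset_of_nonneg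
    (Finset.range_mono (h2 i)) fun j _ _ => pow_nonneg (one_sub_inv_nonneg hd i) _

/-- A greedy allocation that explores every community is suboptimal only if some parameter is
badly estimated. -/
lemma GreedySteps.exists_gap_le_of_pos (hK : m < K) (hd : ∀ i, 1 ≤ d i)
    (hstar : IsOptimal d K kstar) {μ : Fin m → ℝ} (h0 : ∀ i, 0 ≤ μ i) (h1 : ∀ i, μ i ≤ 1)
    {k : Allocation m} (hk : GreedySteps μ K k) (hpos : ∀ i, 1 ≤ k i) (i₀ : Fin m) :
    ∃ i, gap d K kstar k
      ≤ ((K - m + 1 : ℕ) : ℝ) * ((K - m : ℕ) : ℝ) * |μ i - 1 / (d i : ℝ)| := by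
  obtain ⟨k', hs', hpos', hle⟩ := exists_optimal_pos hK hd hstar i₀
  have hs := hk.sum_eq
  obtain ⟨i, -, hi⟩ := Finset.exists_max_image Finset.univ (fun i => |μ i - 1 / (d i : ℝ)|)
    ⟨i₀, Finset.mem_univ _⟩
  refine ⟨i, ?_⟩
  have hgr := hk.sum_le h0 h1 k' hs'
  have hlip (a : Allocation m) (l : Fin m) :
      |∑ j ∈ Finset.range (a l), (1 - μ l) ^ j
        - ∑ j ∈ Finset.range (a l), (1 - 1 / (d l : ℝ)) ^ j|
      ≤ a l * (a l - 1) / 2 * |μ l - 1 / (d l : ℝ)| := by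
    have := abs_sum_pow_sub_le (x := 1 - μ l) (y := 1 - 1 / (d l : ℝ)) (by linarith [h1 l])
      (by linarith [h0 l]) (one_sub_inv_nonneg hd l) (one_sub_inv_lt_one hd l).le (a l)
    rwa [sub_sub_sub_cancel_left, abs_sub_comm (1 / (d l : ℝ))] at this
  -- The bound applies to `k` and to `k'` because both explore every community; the two halves add
  -- up to the full constant.
  have hb (a : Allocation m) (ha : ∑ i, a i = K) (hp : ∀ i, 1 ≤ a i) :=
    sum_choose_two_mul_le hK ha hp (c := fun l => |μ l - 1 / (d l : ℝ)|) (abs_nonneg _)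
      fun l _ => hi l (Finset.mem_univ l)
  have hup : expReward d K k' ≤ ∑ l, ∑ j ∈ Finset.range (k' l), (1 - μ l) ^ j
      + ∑ l, (k' l : ℝ) * (k' l - 1) / 2 * |μ l - 1 / (d l : ℝ)| := by
    rw [expReward_eq hd (le_of_sum_le hs'.le), ← Finset.sum_add_distrib]
    exact Finset.sum_le_sum fun l _ => by linarith [(abs_le.1 (hlip k' l)).1]
  have hlo : ∑ l, ∑ j ∈ Finset.range (k l), (1 - μ l) ^ j
      ≤ expReward d K k + ∑ l, (k l : ℝ) * (k l - 1) / 2 * |μ l - 1 / (d l : ℝ)| := by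
    rw [expReward_eq hd (le_of_sum_le hs.le), ← Finset.sum_add_distrib]
    exact Finset.sum_le_sum fun l _ => by linarith [(abs_le.1 (hlip k l)).2]
  have b1 := hb k' hs' hpos'
  have b2 := hb k hs hpos
  rw [gap]
  linarith

/-- If an allocation leaves a community unexplored, then some community that is explored more
than once has a collision probability that is not small compared to the least gap. -/
lemma exists_gapMin_le_of_eq_zero (hK : m < K) (hd : ∀ i, 1 ≤ d i)
    (hstar : IsOptimal d K kstar) {k : Allocation m} (hk : ∑ i, k i = K) {z : Fin m}
    (hz : k z = 0) :
    ∃ i, 1 < k i ∧ gapMin d K kstar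
      ≤ ENNReal.ofReal (((K - m + 1 : ℕ) : ℝ) * ((K - m : ℕ) : ℝ) * (1 / (d i : ℝ))) := by
  obtain ⟨k', h3, h4, h5, -⟩ := exists_pos_allocation (fun i => 1 - 1 / (d i : ℝ))
    (one_sub_inv_nonneg hd) (fun i => (one_sub_inv_lt_one hd i).le) k (by omega)
  have hs' : ∑ i, k' i = K := h3.trans hk
  have hone (i : Fin m) (hi : 1 < k' i) : 1 < k i := by have := h5 i; omega
  obtain ⟨j, hj⟩ := exists_one_lt_of_lt_sum (hs'.symm ▸ hK)
  have hμ (i : Fin m) : (0 : ℝ) ≤ 1 / (d i : ℝ) := by positivity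
  have hA : (1 : ℝ) ≤ ((K - m : ℕ) : ℝ) := by exact_mod_cast (by omega : 1 ≤ K - m)
  rcases (gap_nonneg hstar hs').eq_or_lt with hg | hg
  -- If the filled-up allocation `k'` is optimal, moving the single exploration of `z` to `j` gives
  -- an allocation with gap `1 - (1 - 1/d_j) ^ k'_j`, which is positive and at most `k'_j / d_j`.
  · refine ⟨j, hone j hj, ?_⟩
    have hz1 : k' z = 1 := by have := h5 z; have := h4 z; omega
    have hjz : j ≠ z := by rintro rfl; omega
    set k₂ := Function.update (Function.update k' z 0) j (k' j + 1) with hk₂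
    have hj' : Function.update k' z 0 j = k' j := Function.update_of_ne hjz _ _
    have hs₂ : ∑ i, k₂ i = K := by
      have e1 := sum_update_add (fun _ n => n) (Function.update k' z 0) j (k' j + 1)
      have e2 := sum_update_add (fun _ n => n) k' z 0
      rw [hj', ← hk₂] at e1
      omega
    have hgap : gap d K kstar k₂ = 1 - (1 - 1 / (d j : ℝ)) ^ k' j := by
      have e1 := sum_update_add (fun i n => ∑ l ∈ Finset.range n, (1 - 1 / (d i : ℝ)) ^ l)
        (Function.update k' z 0) j (k' j + 1)
      have e2 := sum_update_add (fun i n => ∑ l ∈ Finset.range n, (1 - 1 / (d i : ℝ)) ^ l) k' z 0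
      rw [hj', ← hk₂] at e1
      simp only [hz1, Finset.sum_range_succ, Finset.sum_range_zero, Finset.range_one,
        Finset.sum_singleton, pow_zero] at e1 e2
      rw [gap, expReward_eq hd (le_of_sum_le hs'.le)] at hg
      rw [gap, expReward_eq hd (le_of_sum_le hs₂.le)]
      linarith
    have hpow : (1 - 1 / (d j : ℝ)) ^ k' j < 1 :=
      pow_lt_one₀ (one_sub_inv_nonneg hd j) (one_sub_inv_lt_one hd j) (by omega)
    refine (gapMin_le hK hs₂ (by rw [hgap]; linarith)).trans (ENNReal.ofReal_le_ofReal ?_)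
    rw [hgap]
    have hbern := one_add_mul_le_pow (a := -(1 / (d j : ℝ)))
      (by linarith [one_sub_inv_nonneg hd j]) (k' j)
    rw [← sub_eq_add_neg] at hbern
    have hle : (k' j : ℝ) ≤ ((K - m + 1 : ℕ) : ℝ) := by
      exact_mod_cast (by have := le_of_forall_one_le hs' h4 j; omega : k' j ≤ K - m + 1)
    calc 1 - (1 - 1 / (d j : ℝ)) ^ k' j ≤ k' j * (1 / (d j : ℝ)) := by linarith
      _ ≤ ((K - m + 1 : ℕ) : ℝ) * 1 * (1 / (d j : ℝ)) := by rw [mul_one]; gcongr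
      _ ≤ _ := by gcongr
  -- If `k'` is suboptimal, its own gap is at most the shortfall of its reward from `K`, which is a
  -- Lipschitz bound against the parameter `0`.
  · obtain ⟨i, hi, hmax⟩ := Finset.exists_max_image (Finset.univ.filter fun i => 1 < k' i)
      (fun i => 1 / (d i : ℝ)) ⟨j, by simpa using hj⟩
    refine ⟨i, hone i (Finset.mem_filter.1 hi).2,
      (gapMin_le hK hs' hg).trans (ENNReal.ofReal_le_ofReal ?_)⟩
    have hb := sum_choose_two_mul_le hK hs' h4 (hμ i)
      fun l hl => hmax l (Finset.mem_filter.2 ⟨Finset.mem_univ l, hl⟩)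
    have hlip (l : Fin m) : (k' l : ℝ) - ∑ j ∈ Finset.range (k' l), (1 - 1 / (d l : ℝ)) ^ j
        ≤ k' l * (k' l - 1) / 2 * (1 / (d l : ℝ)) := by
      have := (abs_le.1 (abs_sum_pow_sub_le (x := 1) (y := 1 - 1 / (d l : ℝ)) zero_le_one le_rfl
        (one_sub_inv_nonneg hd l) (one_sub_inv_lt_one hd l).le (k' l))).2
      rw [sub_sub_cancel, abs_of_nonneg (hμ l)] at this
      simpa using this
    have hsum := Finset.sum_le_sum fun l (_ : l ∈ Finset.univ) => hlip l
    rw [Finset.sum_sub_distrib, ← Nat.cast_sum, hs', ← expReward_eq hd (le_of_sum_le hs'.le)]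
      at hsum
    have hst := expReward_le_sum hd hstar.1
    have : 0 ≤ ((K - m + 1 : ℕ) : ℝ) * ((K - m : ℕ) : ℝ) / 2 * (1 / (d i : ℝ)) := by
      have := hμ i
      positivity
    rw [gap]
    linarith

/-- In a suboptimal round, the parameter of some explored community is badly estimated. -/
lemma GreedySteps.exists_gapMin_le (hK : m < K) (hd : ∀ i, 1 ≤ d i)
    (hstar : IsOptimal d K kstar) {μ : Fin m → ℝ} (h0 : ∀ i, 0 ≤ μ i) (h1 : ∀ i, μ i ≤ 1)
    {k : Allocation m} (hk : GreedySteps μ K k) (hg : 0 < gap d K kstar k) :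
    ∃ i, 1 ≤ k i ∧ gapMin d K kstar
      ≤ ENNReal.ofReal (((K - m + 1 : ℕ) : ℝ) * ((K - m : ℕ) : ℝ) * |μ i - 1 / (d i : ℝ)|) := by
  by_cases hz : ∃ z, k z = 0
  · obtain ⟨z, hz⟩ := hz
    obtain ⟨i, hi, hle⟩ := exists_gapMin_le_of_eq_zero hK hd hstar hk.sum_eq hz
    refine ⟨i, hi.le, ?_⟩
    rwa [hk.eq_zero_of_one_lt h0 h1 hz hi, zero_sub, abs_neg, abs_of_nonneg (by positivity)]
  · have hpos (i : Fin m) : 1 ≤ k i := Nat.one_le_iff_ne_zero.2 fun h => hz ⟨i, h⟩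
    obtain ⟨i₀, -⟩ := exists_one_lt_of_lt_sum (hk.sum_eq.symm ▸ hK)
    obtain ⟨i, hi⟩ := hk.exists_gap_le_of_pos hK hd hstar h0 h1 hpos i₀
    exact ⟨i, hpos i, (gapMin_le hK hk.sum_eq hg).trans (ENNReal.ofReal_le_ofReal hi)⟩

end Gap

/-! ### Counts of pairs and collisions. -/

section Statistics

variable {m K : ℕ} {d : Fin m → ℕ}

lemma stats_congr {φ φ' : ℕ → Realization d K} {k k' : ℕ → Allocation m} (i : Fin m) {t : ℕ}
    (hφ : ∀ s < t, φ s = φ' s) (hk : ∀ s < t, k s = k' s) :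
    stats φ k i t = stats φ' k' i t := by
  induction t with
  | zero => rfl
  | succ t ih =>
    have := ih (fun s hs => hφ s (by omega)) (fun s hs => hk s (by omega))
    simp only [stats, this, hφ t (by omega), hk t (by omega)]

/-- The number of explorations of community `i` in the first `t` rounds. -/
def pulls (k : ℕ → Allocation m) (i : Fin m) (t : ℕ) : ℕ := ∑ s ∈ Finset.range t, k s i

lemma pulls_succ (k : ℕ → Allocation m) (i : Fin m) (t : ℕ) :
    pulls k i (t + 1) = pulls k i t + k t i := Finset.sum_range_succ _ _

lemma pulls_congr {k k' : ℕ → Allocation m} (i : Fin m) {t : ℕ} (hk : ∀ s < t, k s = k' s) :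
    pulls k i t = pulls k' i t :=
  Finset.sum_congr rfl fun s hs => by rw [hk s (Finset.mem_range.1 hs)]

lemma length_met (φ : Realization d K) (i : Fin m) {n : ℕ} (hn : n ≤ K) :
    (met φ i n).length = n := by
  simp [met, hn]

lemma collisions_le {α : Type} [DecidableEq α] (u : Option α) (S : List α) :
    collisions u S ≤ S.length := by
  induction S generalizing u with
  | nil => simp [collisions]
  | cons v S ih =>
    have := ih (some v)
    simp only [collisions, List.length_cons]
    split_ifs <;> omega

lemma collisions_none_le {α : Type} [DecidableEq α] (S : List α) :
    collisions none S ≤ S.length - 1 := by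
  cases S with
  | nil => simp [collisions]
  | cons v S => simpa [collisions] using collisions_le (some v) S

lemma stats_last_eq_none_iff {φ : ℕ → Realization d K} {k : ℕ → Allocation m} (i : Fin m) {t : ℕ}
    (hk : ∀ s < t, k s i ≤ K) : (stats φ k i t).last = none ↔ pulls k i t = 0 := by
  induction t with
  | zero => simp [stats, pulls]
  | succ t ih =>
    have hlen := length_met (φ t) i (hk t (by omega))
    rw [pulls_succ, Nat.add_eq_zero_iff, ← ih fun s hs => hk s (by omega)]
    simp only [stats, Option.or_eq_none_iff, List.getLast?_eq_none_iff]
    rw [← List.length_eq_zero_iff, hlen, and_comm]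

/-- The first round deducts `1` even from communities it does not explore. Such a community has `T =
-1` until its first exploration, whose first member forms no pair, so the count is right from then
on. -/
lemma stats_T_eq {φ : ℕ → Realization d K} {k : ℕ → Allocation m} (i : Fin m) {t : ℕ}
    (hk : ∀ s < t, k s i ≤ K) :
    (stats φ k i t).T = pulls k i t - if t = 0 then 0 else 1 := by
  induction t with
  | zero => simp [stats, pulls]
  | succ t ih =>
    have hlen := length_met (φ t) i (hk t (by omega))
    have := ih fun s hs => hk s (by omega)
    simp only [stats, this, hlen, pulls_succ]
    push_cast
    split_ifs <;> omega

lemma stats_X_le {φ : ℕ → Realization d K} {k : ℕ → Allocation m} (i : Fin m) {t : ℕ}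
    (hk : ∀ s < t, k s i ≤ K) : (stats φ k i t).X ≤ pulls k i t - 1 := by
  induction t with
  | zero => simp [stats]
  | succ t ih =>
    have hk' : ∀ s < t, k s i ≤ K := fun s hs => hk s (by omega)
    have hlen := length_met (φ t) i (hk t (by omega))
    have h1 := ih hk'
    have h2 := stats_last_eq_none_iff (φ := φ) i hk'
    rw [pulls_succ]
    simp only [stats]
    cases hl : (stats φ k i t).last with
    | none =>
      have := collisions_none_le (met (φ t) i (k t i))
      have := h2.1 hl
      omega
    | some u =>
      have := collisions_le (some u) (met (φ t) i (k t i))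
      have : pulls k i t ≠ 0 := fun h => by simp [h2.2 h] at hl
      omega

/-- The empirical mean, with the number of pairs expressed by the number of explorations. -/
lemma empMean_eq {φ : ℕ → Realization d K} {k : ℕ → Allocation m} (i : Fin m) {t : ℕ}
    (hk : ∀ s < t, k s i ≤ K) :
    empMean φ k t i = (stats φ k i t).X / ((pulls k i t - 1 : ℕ) : ℝ) := by
  have hT := stats_T_eq (φ := φ) i hk
  have hX := stats_X_le (φ := φ) i hk
  have h0 : t = 0 → pulls k i t = 0 := by rintro rfl; simp [pulls]
  rw [empMean]
  split_ifs with h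
  · congr 1
    have : (stats φ k i t).T = ((pulls k i t - 1 : ℕ) : ℤ) := by
      split_ifs at hT <;> omega
    rw [this, Int.cast_natCast]
  · have : pulls k i t - 1 = 0 := by
      split_ifs at hT with ht
      · have := h0 ht; omega
      · omega
    -- Without pairs the quotient has denominator `0`, and its value `0` agrees with the initial
    -- value of the empirical mean.
    simp [this]

lemma empMean_nonneg (φ : ℕ → Realization d K) (k : ℕ → Allocation m) (t : ℕ) (i : Fin m) :
    0 ≤ empMean φ k t i := by
  rw [empMean]
  split_ifs with h
  · have : (0 : ℝ) < (stats φ k i t).T := by exact_mod_cast h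
    positivity
  · exact le_rfl

lemma empMean_le_one {φ : ℕ → Realization d K} {k : ℕ → Allocation m} (i : Fin m) {t : ℕ}
    (hk : ∀ s < t, k s i ≤ K) : empMean φ k t i ≤ 1 := by
  rw [empMean_eq i hk]
  exact div_le_one_of_le₀ (by exact_mod_cast stats_X_le i hk) (by positivity)

end Statistics

/-! ### Exponential potentials. -/

section Potential

variable {m K : ℕ} {d : Fin m → ℕ}

/-- The exponential potential of community `i` after `t` rounds; its expectation decreases in
every round in which the community is explored. -/
noncomputable def potential (c : ℝ) (φ : ℕ → Realization d K) (k : ℕ → Allocation m) (i : Fin m) (t : ℕ) : ℝ :=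
  Real.exp (c * (stats φ k i t).X - (c / d i + c ^ 2) * (pulls k i t - 1 : ℕ)
    - c ^ 2 * pulls k i t)

lemma potential_congr (c : ℝ) {φ φ' : ℕ → Realization d K} {k k' : ℕ → Allocation m} (i : Fin m)
    {t : ℕ} (hφ : ∀ s < t, φ s = φ' s) (hk : ∀ s < t, k s = k' s) :
    potential c φ k i t = potential c φ' k' i t := by
  rw [potential, potential, stats_congr i hφ hk, pulls_congr i hk]

lemma potential_zero (c : ℝ) (φ : ℕ → Realization d K) (k : ℕ → Allocation m) (i : Fin m) :
    potential c φ k i 0 = 1 := by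
  simp [potential, stats, pulls]

lemma potential_succ (c : ℝ) {φ : ℕ → Realization d K} {k : ℕ → Allocation m} (i : Fin m) {t : ℕ}
    (hk : ∀ s < t, k s i ≤ K) :
    potential c φ k i (t + 1) = Real.exp (c * collisions (stats φ k i t).last (met (φ t) i (k t i)))
      * (potential c φ k i t * Real.exp (-((c / d i + c ^ 2)
          * (if (stats φ k i t).last = none then k t i - 1 else k t i : ℕ)) - c ^ 2 * k t i)) := by
  have hlast := stats_last_eq_none_iff (φ := φ) i hk
  -- The number of new pairs: one less than the number of meetings if no member was met before.
  have hN : ((pulls k i t + k t i - 1 : ℕ) : ℝ) = (pulls k i t - 1 : ℕ)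
      + ((if (stats φ k i t).last = none then k t i - 1 else k t i : ℕ) : ℝ) := by
    norm_cast
    split_ifs with h
    · have := hlast.1 h; omega
    · have := mt hlast.2 h; omega
  rw [potential, potential, ← Real.exp_add, ← Real.exp_add, pulls_succ, hN]
  congr 1
  simp only [stats]
  push_cast
  ring

/-- A badly estimated parameter makes one of the potentials large. -/
lemma one_le_potential_add {c : ℝ} (hc : 0 ≤ c) {φ : ℕ → Realization d K}
    {k : ℕ → Allocation m} (i : Fin m) {t : ℕ} (hk : ∀ s < t, k s i ≤ K)
    (h : 2 * c ≤ |empMean φ k t i - 1 / (d i : ℝ)|) :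
    1 ≤ Real.exp (c ^ 2) * (potential c φ k i t + potential (-c) φ k i t) := by
  rw [empMean_eq i hk] at h
  have hX := stats_X_le (φ := φ) i hk
  set X := (stats φ k i t).X
  set n := pulls k i t - 1 with hn
  have hN : (pulls k i t : ℝ) ≤ n + 1 := by exact_mod_cast (by omega : pulls k i t ≤ n + 1)
  have hdev : 2 * c * n ≤ |(X : ℝ) - n / d i| := by
    rcases Nat.eq_zero_or_pos n with h0 | h0
    · rw [h0, Nat.cast_zero, mul_zero]; exact abs_nonneg _
    · have h0' : (0 : ℝ) < n := by exact_mod_cast h0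
      calc 2 * c * n ≤ |(X : ℝ) / n - 1 / d i| * |(n : ℝ)| := by
            rw [abs_of_pos h0']; gcongr
        _ = |(X : ℝ) - n / d i| := by rw [← abs_mul]; congr 1; field_simp
  -- The exponent is at least `2c²n - c²n - c²(n + 1) = -c²`; the sign of `b` is that of the
  -- deviation.
  have key (b : ℝ) (hb : b ^ 2 = c ^ 2) (hdev : c * (2 * c * n) ≤ b * (X - n / d i)) :
      1 ≤ Real.exp (c ^ 2) * potential b φ k i t := by
    rw [potential, ← Real.exp_add, Real.one_le_exp_iff, hb]
    have h1 : c ^ 2 * (pulls k i t : ℝ) ≤ c ^ 2 * (n + 1) :=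
      mul_le_mul_of_nonneg_left hN (sq_nonneg c)
    have h2 : b * (X - n / d i) = b * X - b / d i * n := by ring
    change 0 ≤ c ^ 2 + (b * X - (b / d i + c ^ 2) * n - c ^ 2 * pulls k i t)
    nlinarith
  have hp (b : ℝ) : 0 ≤ Real.exp (c ^ 2) * potential b φ k i t :=
    mul_nonneg (Real.exp_pos _).le (Real.exp_pos _).le
  rw [mul_add]
  rcases le_abs.1 hdev with h1 | h1
  · linarith [key c rfl (mul_le_mul_of_nonneg_left h1 hc), hp (-c)]
  · linarith [key (-c) (neg_sq c) (by nlinarith [mul_le_mul_of_nonneg_left h1 hc]), hp c]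

end Potential

/-! ### Conditioning on the past of a run. -/

section Run

variable {m K T : ℕ} {d : Fin m → ℕ} {Ω : Type*} [MeasurableSpace Ω] {P : Measure Ω}
  {Φ : ℕ → Ω → Realization d K} {k : ℕ → Ω → Allocation m}

lemma IsRun.measurable_past (hrun : IsRun d K T P Φ k) {t : ℕ} (ht : t < T) :
    Measurable fun ω => ((fun s : Fin t => Φ s ω), (fun s : Fin (t + 1) => k s ω)) :=
  (measurable_pi_lambda _ fun s : Fin t =>
    hrun.measurable_realization s (s.2.trans ht)).prodMk
    (measurable_pi_lambda _ fun s : Fin (t + 1) =>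
      hrun.measurable_allocation s (by have := s.2; omega))

lemma IsRun.sum_eq (hrun : IsRun d K T P Φ k) {t : ℕ} (ht : t < T) (ω : Ω) :
    ∑ i, k t ω i = K := (hrun.greedy t ht ω).sum_eq

lemma IsRun.allocation_le (hrun : IsRun d K T P Φ k) {t : ℕ} (ht : t < T) (ω : Ω) (i : Fin m) :
    k t ω i ≤ K := le_of_sum_le (hrun.sum_eq ht ω).le i

/-- Independence and Tonelli: the past, including the current allocation, is frozen while the new
realization is averaged. Any `f` is allowed, because its arguments range over countable discrete
spaces. -/
lemma IsRun.lintegral_eq [IsProbabilityMeasure P] (hrun : IsRun d K T P Φ k)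
    (hd : ∀ i, 1 ≤ d i) {t : ℕ} (ht : t < T)
    (f : (Fin t → Realization d K) × (Fin (t + 1) → Allocation m) → Realization d K → ℝ≥0∞) :
    ∫⁻ ω, f ((fun s : Fin t => Φ s ω), (fun s : Fin (t + 1) => k s ω)) (Φ t ω) ∂P
      = ∫⁻ ω, ∫⁻ φ, f ((fun s : Fin t => Φ s ω), (fun s : Fin (t + 1) => k s ω)) φ
          ∂(realizationLaw d K) ∂P := by
  have := isProbabilityMeasure_realizationLaw (K := K) hd
  have hpast := hrun.measurable_past ht
  have hΦ := hrun.measurable_realization t ht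
  have hmap := (indepFun_iff_map_prod_eq_prod_map_map hpast.aemeasurable hΦ.aemeasurable).1
    (hrun.indep t ht)
  have e := lintegral_map (μ := P) (f := Function.uncurry f) .of_discrete (hpast.prodMk hΦ)
  rw [hmap, hrun.law t ht, lintegral_prod _ (Measurable.of_discrete).aemeasurable,
    lintegral_map .of_discrete hpast] at e
  exact e.symm

/-- The sequence that starts with the tuple `p` and continues with the constant `a`. -/
def extend {α : Type*} {t : ℕ} (p : Fin t → α) (a : α) (s : ℕ) : α :=
  if h : s < t then p ⟨s, h⟩ else a

lemma extend_of_lt {α : Type*} {t : ℕ} (p : ℕ → α) (a : α) {s : ℕ} (h : s < t) :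
    extend (fun s : Fin t => p s) a s = p s := by
  simp [extend, h]

lemma extend_self {α : Type*} {t : ℕ} (p : Fin t → α) (a : α) : extend p a t = a := by
  simp [extend]

/-- The potential after `t` rounds factors through the discrete finite past, so the values with
which `extend` pads the sequences are irrelevant. -/
lemma IsRun.measurable_potential (hrun : IsRun d K T P Φ k) (hd : ∀ i, 1 ≤ d i) {t : ℕ}
    (ht : t < T) (c : ℝ) (i : Fin m) :
    Measurable fun ω => potential c (fun s => Φ s ω) (fun s => k s ω) i t := by
  have h := (Measurable.of_discrete (f := fun p : (Fin t → Realization d K)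
    × (Fin (t + 1) → Allocation m) => potential c (extend p.1 fun i _ => ⟨0, hd i⟩)
      (extend p.2 fun _ => 0) i t)).comp (hrun.measurable_past ht)
  convert h using 2 with ω
  exact potential_congr c i (fun s hs => (extend_of_lt (fun s => Φ s ω) _ hs).symm)
    fun s hs => (extend_of_lt (fun s => k s ω) _ (by omega)).symm

/-- Given the past, the exponential moment of the new collisions is absorbed by the compensator `(c
/ d i + c ^ 2)` per new pair. Only the discount `c ^ 2` per exploration remains. -/
lemma IsRun.lintegral_potential_succ_le [IsProbabilityMeasure P] (hrun : IsRun d K T P Φ k)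
    (hd : ∀ i, 1 ≤ d i) {t : ℕ} (ht : t < T) {c : ℝ} (hc : |c| ≤ 1) (i : Fin m) :
    ∫⁻ ω, ENNReal.ofReal (potential c (fun s => Φ s ω) (fun s => k s ω) i (t + 1)) ∂P
      ≤ ∫⁻ ω, ENNReal.ofReal (potential c (fun s => Φ s ω) (fun s => k s ω) i t
          * Real.exp (-(c ^ 2 * k t ω i))) ∂P := by
  have e := hrun.lintegral_eq hd ht fun p φ => ENNReal.ofReal
    (potential c (extend p.1 φ) (extend p.2 fun _ => 0) i (t + 1))
  have hk (ω : Ω) (s : ℕ) (hs : s < t + 1) :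
      extend (fun s : Fin (t + 1) => k s ω) (fun _ => 0) s = k s ω :=
    extend_of_lt (fun s => k s ω) _ hs
  have hl (ω : Ω) : potential c (extend (fun s : Fin t => Φ s ω) (Φ t ω))
      (extend (fun s : Fin (t + 1) => k s ω) fun _ => 0) i (t + 1)
      = potential c (fun s => Φ s ω) (fun s => k s ω) i (t + 1) := by
    refine potential_congr c i (fun s hs => ?_) (hk ω)
    rcases (Nat.lt_succ_iff.1 hs).eq_or_lt with rfl | h
    · exact extend_self _ _
    · exact extend_of_lt (fun s => Φ s ω) _ h
  simp only [hl] at e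
  rw [e]
  refine lintegral_mono fun ω => ?_
  have hst (φ : Realization d K) : stats (extend (fun s : Fin t => Φ s ω) φ)
      (extend (fun s : Fin (t + 1) => k s ω) fun _ => 0) i t
      = stats (fun s => Φ s ω) (fun s => k s ω) i t :=
    stats_congr i (fun s hs => extend_of_lt (fun s => Φ s ω) _ hs) fun s hs => hk ω s (by omega)
  have hpo (φ : Realization d K) : potential c (extend (fun s : Fin t => Φ s ω) φ)
      (extend (fun s : Fin (t + 1) => k s ω) fun _ => 0) i t
      = potential c (fun s => Φ s ω) (fun s => k s ω) i t :=
    potential_congr c i (fun s hs => extend_of_lt (fun s => Φ s ω) _ hs)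
      fun s hs => hk ω s (by omega)
  set u := (stats (fun s => Φ s ω) (fun s => k s ω) i t).last with hu
  set V := potential c (fun s => Φ s ω) (fun s => k s ω) i t with hV
  set l := (if u = none then k t ω i - 1 else k t ω i : ℕ) with hl
  have hstep (φ : Realization d K) : potential c (extend (fun s : Fin t => Φ s ω) φ)
      (extend (fun s : Fin (t + 1) => k s ω) fun _ => 0) i (t + 1)
      = Real.exp (c * collisions u (met φ i (k t ω i)))
        * (V * Real.exp (-((c / d i + c ^ 2) * l) - c ^ 2 * k t ω i)) := by
    rw [potential_succ c i fun s hs => by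
      rw [hk ω s (by omega)]; exact hrun.allocation_le (by omega) ω i]
    rw [hst, hpo, hk ω t (by omega), extend_self]
  have hV0 : 0 ≤ V := (Real.exp_pos _).le
  calc ∫⁻ φ, ENNReal.ofReal (potential c (extend (fun s : Fin t => Φ s ω) φ)
        (extend (fun s : Fin (t + 1) => k s ω) fun _ => 0) i (t + 1)) ∂(realizationLaw d K)
      = (∫⁻ φ, ENNReal.ofReal (Real.exp (c * collisions u (met φ i (k t ω i))))
          ∂(realizationLaw d K))
        * ENNReal.ofReal (V * Real.exp (-((c / d i + c ^ 2) * l) - c ^ 2 * k t ω i)) := by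
        rw [← lintegral_mul_const _ .of_discrete]
        refine lintegral_congr fun φ => ?_
        rw [hstep, ENNReal.ofReal_mul (Real.exp_pos _).le]
    _ ≤ ENNReal.ofReal (Real.exp ((c / d i + c ^ 2) * l))
        * ENNReal.ofReal (V * Real.exp (-((c / d i + c ^ 2) * l) - c ^ 2 * k t ω i)) := by
        gcongr
        exact lintegral_exp_collisions_le hd i hc (hrun.allocation_le ht ω i) u
    _ = _ := by
        rw [← ENNReal.ofReal_mul (Real.exp_pos _).le]
        congr 1
        rw [mul_left_comm, ← Real.exp_add]
        congr 2
        ring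

/-- The potentials at the rounds in which community `i` is explored have a bounded sum. -/
lemma IsRun.sum_lintegral_potential_le [IsProbabilityMeasure P] (hrun : IsRun d K T P Φ k)
    (hd : ∀ i, 1 ≤ d i) {c : ℝ} (hc : |c| ≤ 1) (i : Fin m) {t : ℕ} (ht : t ≤ T) :
    ∫⁻ ω, ENNReal.ofReal (potential c (fun s => Φ s ω) (fun s => k s ω) i t) ∂P
      + ENNReal.ofReal (1 - Real.exp (-c ^ 2)) * ∑ s ∈ Finset.range t,
        ∫⁻ ω, (if 1 ≤ k s ω i then
          ENNReal.ofReal (potential c (fun s => Φ s ω) (fun s => k s ω) i s) else 0) ∂P ≤ 1 := by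
  induction t with
  | zero => simp [potential_zero]
  | succ t ih =>
    refine le_trans ?_ (ih (by omega))
    rw [Finset.sum_range_succ, mul_add, ← add_assoc, add_right_comm]
    refine add_le_add_left ?_ _
    refine (add_le_add (hrun.lintegral_potential_succ_le hd (by omega) hc i)
      (lintegral_const_mul_le _ _)).trans ?_
    refine (le_lintegral_add _ _).trans (lintegral_mono fun ω => ?_)
    set V := potential c (fun s => Φ s ω) (fun s => k s ω) i t
    have hV0 : 0 ≤ V := (Real.exp_pos _).le
    have h1 : Real.exp (-c ^ 2) ≤ 1 := Real.exp_le_one_iff.2 (by nlinarith [sq_nonneg c])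
    simp only
    split_ifs with h
    · rw [← ENNReal.ofReal_mul (by linarith), ← ENNReal.ofReal_add
        (mul_nonneg hV0 (Real.exp_pos _).le) (mul_nonneg (by linarith) hV0)]
      refine ENNReal.ofReal_le_ofReal ?_
      have h2 : Real.exp (-(c ^ 2 * k t ω i)) ≤ Real.exp (-c ^ 2) := by
        refine Real.exp_le_exp.2 ?_
        have : (1 : ℝ) ≤ k t ω i := by exact_mod_cast h
        nlinarith [sq_nonneg c]
      nlinarith
    · rw [mul_zero, add_zero]
      obtain h0 : k t ω i = 0 := by omega
      simp [h0]

lemma IsRun.integral_eq [IsProbabilityMeasure P] (hrun : IsRun d K T P Φ k)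
    (hd : ∀ i, 1 ≤ d i) {t : ℕ} (ht : t < T) {f : Allocation m → Realization d K → ℝ} {C : ℝ}
    (hf : ∀ a φ, |f a φ| ≤ C) :
    Integrable (fun ω => f (k t ω) (Φ t ω)) P ∧
      ∫ ω, f (k t ω) (Φ t ω) ∂P = ∫ ω, ∫ φ, f (k t ω) φ ∂(realizationLaw d K) ∂P := by
  have := isProbabilityMeasure_realizationLaw (K := K) hd
  have hk := hrun.measurable_allocation t ht
  have hΦ := hrun.measurable_realization t ht
  have hind : IndepFun (k t) (Φ t) P := (hrun.indep t ht).comp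
    (φ := fun p : (Fin t → Realization d K) × (Fin (t + 1) → Allocation m) => p.2 (Fin.last t)) (ψ := id) .of_discrete measurable_id
  have hmap := (indepFun_iff_map_prod_eq_prod_map_map hk.aemeasurable hΦ.aemeasurable).1 hind
  rw [hrun.law t ht] at hmap
  have hmeas : Measurable (Function.uncurry f) := .of_discrete
  have hpk : IsProbabilityMeasure (P.map (k t)) := Measure.isProbabilityMeasure_map hk.aemeasurable
  refine ⟨.of_bound (hmeas.comp (hk.prodMk hΦ)).aestronglyMeasurable C
    (.of_forall fun ω => hf _ _), ?_⟩
  have e := integral_map (μ := P) (hk.prodMk hΦ).aemeasurable hmeas.aestronglyMeasurable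
  rw [hmap, integral_prod _ (.of_bound hmeas.aestronglyMeasurable C
    (.of_forall fun p => hf _ _)), integral_map hk.aemeasurable
    (Measurable.of_discrete).aestronglyMeasurable] at e
  exact e.symm

lemma ofReal_integral_le_lintegral {α : Type*} [MeasurableSpace α] {ν : Measure α} (f : α → ℝ) :
    ENNReal.ofReal (∫ x, f x ∂ν) ≤ ∫⁻ x, ENNReal.ofReal (f x) ∂ν := by
  by_cases hf : Integrable f ν
  · calc ENNReal.ofReal (∫ x, f x ∂ν) ≤ ENNReal.ofReal (∫ x, max (f x) 0 ∂ν) :=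
          ENNReal.ofReal_le_ofReal (integral_mono hf hf.pos_part fun x => le_max_left _ _)
      _ = ∫⁻ x, ENNReal.ofReal (max (f x) 0) ∂ν :=
          ofReal_integral_eq_lintegral_ofReal hf.pos_part (.of_forall fun x => le_max_right _ _)
      _ = _ := by simp [ENNReal.ofReal_max]
  · simp [integral_undef hf]

lemma reward_le (a : Allocation m) (φ : Realization d K) : reward a φ ≤ Finset.univ.sum d :=
  Finset.sum_le_sum fun _ _ => (Finset.card_le_univ _).trans (Fintype.card_fin _).le

/-- The regret is at most the expected sum of the gaps of the allocations. -/
lemma IsRun.ofReal_regret_le [IsProbabilityMeasure P] (hrun : IsRun d K T P Φ k)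
    (hd : ∀ i, 1 ≤ d i) {kstar : Allocation m} :
    ENNReal.ofReal (regret T P Φ k kstar)
      ≤ ∑ t ∈ Finset.range T, ∫⁻ ω, ENNReal.ofReal (gap d K kstar (k t ω)) ∂P := by
  have := isProbabilityMeasure_realizationLaw (K := K) hd
  have hbound (a : Allocation m) (φ : Realization d K) :
      |(reward kstar φ : ℝ) - reward a φ| ≤ (Finset.univ.sum d : ℕ) := by
    have h1 : (reward kstar φ : ℝ) ≤ (Finset.univ.sum d : ℕ) := by exact_mod_cast reward_le _ _
    have h2 : (reward a φ : ℝ) ≤ (Finset.univ.sum d : ℕ) := by exact_mod_cast reward_le _ _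
    rw [abs_le]
    constructor <;> linarith [(reward kstar φ).cast_nonneg (α := ℝ),
      (reward a φ).cast_nonneg (α := ℝ)]
  have hrew (t : ℕ) (ht : t < T) := hrun.integral_eq hd ht hbound
  rw [regret, integral_finsetSum _ fun t ht => (hrew t (Finset.mem_range.1 ht)).1]
  refine (Finset.le_sum_of_subadditive ENNReal.ofReal ENNReal.ofReal_zero.le
    (fun _ _ => ENNReal.ofReal_add_le) _ _).trans (Finset.sum_le_sum fun t ht => ?_)
  rw [(hrew t (Finset.mem_range.1 ht)).2]
  have hg (ω : Ω) : ∫ φ, ((reward kstar φ : ℝ) - reward (k t ω) φ) ∂(realizationLaw d K)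
      = gap d K kstar (k t ω) := integral_sub .of_finite .of_finite
  simp_rw [hg]
  exact ofReal_integral_le_lintegral _

end Run

/-! ### The numerical constant. -/

section Constant

/-- Since `1 - exp (-x) ≥ x exp (-x)`, it suffices that `4 exp (2x) ≤ e²`. For `x ≤ 1/4` this
follows from `e · exp (1 - 2x) ≥ e (2 - 2x) ≥ 3e/2 > 4`. -/
lemma exp_div_one_sub_exp_le {x : ℝ} (hx0 : 0 < x) (hx1 : x ≤ 1 / 4) :
    Real.exp x / (1 - Real.exp (-x)) ≤ Real.exp 1 ^ 2 / (4 * x) := by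
  have h1 : x * Real.exp (-x) ≤ 1 - Real.exp (-x) := by
    have := mul_le_mul_of_nonneg_right (Real.add_one_le_exp x) (Real.exp_pos (-x)).le
    rw [← Real.exp_add, add_neg_cancel, Real.exp_zero] at this
    linarith
  have h2 : 0 < x * Real.exp (-x) := mul_pos hx0 (Real.exp_pos _)
  rw [div_le_div_iff₀ (by linarith) (by linarith)]
  have h3 : Real.exp x * 4 ≤ Real.exp 1 ^ 2 * Real.exp (-x) := by
    have e : Real.exp 1 ^ 2 * Real.exp (-x)
        = Real.exp x * (Real.exp 1 * Real.exp (1 - 2 * x)) := by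
      rw [sq, ← Real.exp_add, ← Real.exp_add, ← Real.exp_add, ← Real.exp_add]
      congr 1
      ring
    rw [e]
    refine mul_le_mul_of_nonneg_left ?_ (Real.exp_pos _).le
    have := Real.exp_one_gt_d9
    have := Real.add_one_le_exp (1 - 2 * x)
    nlinarith
  calc Real.exp x * (4 * x) = Real.exp x * 4 * x := by ring
    _ ≤ Real.exp 1 ^ 2 * Real.exp (-x) * x := by gcongr
    _ = Real.exp 1 ^ 2 * (x * Real.exp (-x)) := by ring
    _ ≤ _ := by gcongr

end Constant

/-! ### Summing over rounds and communities. -/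

section Regret

variable {m K T : ℕ} {d : Fin m → ℕ} {Ω : Type*} [MeasurableSpace Ω] {P : Measure Ω}
  {Φ : ℕ → Ω → Realization d K} {k : ℕ → Ω → Allocation m} {kstar : Allocation m}

lemma IsRun.exists_gapMin_le (hrun : IsRun d K T P Φ k) (hK : m < K) (hd : ∀ i, 1 ≤ d i)
    (hstar : IsOptimal d K kstar) {t : ℕ} (ht : t < T) {ω : Ω}
    (hg : 0 < gap d K kstar (k t ω)) :
    ∃ i, 1 ≤ k t ω i ∧ gapMin d K kstar
      ≤ ENNReal.ofReal (((K - m + 1 : ℕ) : ℝ) * ((K - m : ℕ) : ℝ)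
        * |empMean (fun s => Φ s ω) (fun s => k s ω) t i - 1 / (d i : ℝ)|) :=
  (hrun.greedy t ht ω).exists_gapMin_le hK hd hstar (fun i => empMean_nonneg _ _ t i)
    (fun i => empMean_le_one i fun _ hs => hrun.allocation_le (hs.trans ht) ω i) hg

/-- The potentials control the gap of every round. -/
lemma IsRun.ofReal_gap_le (hrun : IsRun d K T P Φ k) (hK : m < K) (hd : ∀ i, 1 ≤ d i)
    (hstar : IsOptimal d K kstar) {c : ℝ} (hc : 0 ≤ c)
    (hmin : ENNReal.ofReal (((K - m + 1 : ℕ) : ℝ) * ((K - m : ℕ) : ℝ) * (2 * c))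
      = gapMin d K kstar) {t : ℕ} (ht : t < T) (ω : Ω) :
    ENNReal.ofReal (gap d K kstar (k t ω)) ≤ gapMax d K kstar * (ENNReal.ofReal (Real.exp (c ^ 2))
      * ∑ i, ((if 1 ≤ k t ω i then
          ENNReal.ofReal (potential c (fun s => Φ s ω) (fun s => k s ω) i t) else 0)
        + if 1 ≤ k t ω i then
          ENNReal.ofReal (potential (-c) (fun s => Φ s ω) (fun s => k s ω) i t) else 0)) := by
  rcases le_or_gt (gap d K kstar (k t ω)) 0 with hg | hg
  · simp [ENNReal.ofReal_of_nonpos hg]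
  obtain ⟨i, hi, hle⟩ := hrun.exists_gapMin_le hK hd hstar ht hg
  have hA : (0 : ℝ) < ((K - m + 1 : ℕ) : ℝ) * ((K - m : ℕ) : ℝ) := by
    have : 0 < K - m := by omega
    positivity
  rw [← hmin, ENNReal.ofReal_le_ofReal_iff (mul_nonneg hA.le (abs_nonneg _)),
    mul_le_mul_iff_right₀ hA] at hle
  have hone := one_le_potential_add hc i
    (fun s hs => hrun.allocation_le (hs.trans ht) ω i) hle
  refine (le_gapMax hK (hrun.sum_eq ht ω) hg).trans ?_
  refine le_mul_of_one_le_right' ?_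
  have hp (b : ℝ) : 0 ≤ potential b (fun s => Φ s ω) (fun s => k s ω) i t := (Real.exp_pos _).le
  calc (1 : ℝ≥0∞) ≤ ENNReal.ofReal (Real.exp (c ^ 2)
        * (potential c (fun s => Φ s ω) (fun s => k s ω) i t
          + potential (-c) (fun s => Φ s ω) (fun s => k s ω) i t)) :=
        ENNReal.one_le_ofReal.2 hone
    _ = ENNReal.ofReal (Real.exp (c ^ 2)) * ((if 1 ≤ k t ω i then
          ENNReal.ofReal (potential c (fun s => Φ s ω) (fun s => k s ω) i t) else 0)
        + if 1 ≤ k t ω i then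
          ENNReal.ofReal (potential (-c) (fun s => Φ s ω) (fun s => k s ω) i t) else 0) := by
        rw [if_pos hi, if_pos hi, ENNReal.ofReal_mul (Real.exp_pos _).le,
          ENNReal.ofReal_add (hp c) (hp (-c))]
    _ ≤ _ := by
        gcongr
        exact Finset.single_le_sum (f := fun i => (if 1 ≤ k t ω i then
          ENNReal.ofReal (potential c (fun s => Φ s ω) (fun s => k s ω) i t) else 0)
        + if 1 ≤ k t ω i then
          ENNReal.ofReal (potential (-c) (fun s => Φ s ω) (fun s => k s ω) i t) else 0)
          (fun _ _ => zero_le) (Finset.mem_univ i)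

lemma IsRun.measurable_ite_potential (hrun : IsRun d K T P Φ k) (hd : ∀ i, 1 ≤ d i) {t : ℕ}
    (ht : t < T) (c : ℝ) (i : Fin m) :
    Measurable fun ω => if 1 ≤ k t ω i then
      ENNReal.ofReal (potential c (fun s => Φ s ω) (fun s => k s ω) i t) else 0 :=
  Measurable.ite (((measurable_pi_apply i).comp (hrun.measurable_allocation t ht))
      (.of_discrete (s := {n | 1 ≤ n})))
    (hrun.measurable_potential hd ht c i).ennreal_ofReal measurable_const

lemma IsRun.sum_lintegral_ite_potential_le [IsProbabilityMeasure P] (hrun : IsRun d K T P Φ k)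
    (hd : ∀ i, 1 ≤ d i) {c : ℝ} (hc0 : c ≠ 0) (hc : |c| ≤ 1) (i : Fin m) :
    ∑ t ∈ Finset.range T, ∫⁻ ω, (if 1 ≤ k t ω i then
      ENNReal.ofReal (potential c (fun s => Φ s ω) (fun s => k s ω) i t) else 0) ∂P
      ≤ (ENNReal.ofReal (1 - Real.exp (-c ^ 2)))⁻¹ := by
  have h := (le_add_self).trans (hrun.sum_lintegral_potential_le hd hc i le_rfl)
  rw [← one_div]
  refine (ENNReal.le_div_iff_mul_le (.inl ?_) (.inl ENNReal.ofReal_ne_top)).2 (by rwa [mul_comm])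
  have : Real.exp (-c ^ 2) < 1 := Real.exp_lt_one_iff.2 (by have := sq_pos_of_ne_zero hc0; linarith)
  exact (ENNReal.ofReal_pos.2 (by linarith)).ne'

/-- The factor `2 * m` counts the two signs of the deviation in each community. -/
lemma IsRun.ofReal_regret_le_gapMax_mul [IsProbabilityMeasure P] (hrun : IsRun d K T P Φ k)
    (hK : m < K) (hd : ∀ i, 1 ≤ d i) (hstar : IsOptimal d K kstar) {c : ℝ} (hc0 : 0 < c)
    (hc1 : c ≤ 1)
    (hmin : ENNReal.ofReal (((K - m + 1 : ℕ) : ℝ) * ((K - m : ℕ) : ℝ) * (2 * c))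
      = gapMin d K kstar) :
    ENNReal.ofReal (regret T P Φ k kstar) ≤ gapMax d K kstar
      * ENNReal.ofReal (2 * m * (Real.exp (c ^ 2) / (1 - Real.exp (-c ^ 2)))) := by
  have hpos : 0 < 1 - Real.exp (-c ^ 2) := by
    have : Real.exp (-c ^ 2) < 1 := Real.exp_lt_one_iff.2 (by have := sq_pos_of_pos hc0; linarith)
    linarith
  set W : ℝ → Fin m → ℕ → Ω → ℝ≥0∞ := fun b i t ω => if 1 ≤ k t ω i then
    ENNReal.ofReal (potential b (fun s => Φ s ω) (fun s => k s ω) i t) else 0 with hW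
  have hmeas (b : ℝ) (i : Fin m) (t : ℕ) (ht : t < T) : Measurable (W b i t) :=
    hrun.measurable_ite_potential hd ht b i
  have hsum (b : ℝ) (hb : b = c ∨ b = -c) (i : Fin m) :
      ∑ t ∈ Finset.range T, ∫⁻ ω, W b i t ω ∂P ≤ (ENNReal.ofReal (1 - Real.exp (-c ^ 2)))⁻¹ := by
    have hsq : b ^ 2 = c ^ 2 := by rcases hb with rfl | rfl <;> ring
    rw [← hsq]
    refine hrun.sum_lintegral_ite_potential_le hd ?_ ?_ i
    · rcases hb with rfl | rfl
      · exact hc0.ne'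
      · exact neg_ne_zero.2 hc0.ne'
    · rcases hb with rfl | rfl <;> simpa [abs_of_pos hc0] using hc1
  have hround (t : ℕ) (ht : t ∈ Finset.range T) :
      ∫⁻ ω, ENNReal.ofReal (gap d K kstar (k t ω)) ∂P ≤ gapMax d K kstar
        * (ENNReal.ofReal (Real.exp (c ^ 2))
          * ∑ i, (∫⁻ ω, W c i t ω ∂P + ∫⁻ ω, W (-c) i t ω ∂P)) := by
    have ht' := Finset.mem_range.1 ht
    have hms (i : Fin m) : Measurable fun ω => W c i t ω + W (-c) i t ω :=
      (hmeas c i t ht').add (hmeas (-c) i t ht')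
    refine (lintegral_mono fun ω => hrun.ofReal_gap_le hK hd hstar hc0.le hmin ht' ω).trans ?_
    have hms' : Measurable fun ω => ∑ i, (W c i t ω + W (-c) i t ω) :=
      Finset.measurable_fun_sum _ fun i _ => hms i
    rw [lintegral_const_mul _ (hms'.const_mul _), lintegral_const_mul _ hms',
      lintegral_finsetSum _ fun i _ => hms i]
    simp_rw [lintegral_add_left (hmeas c _ t ht')]
    exact le_rfl
  refine (hrun.ofReal_regret_le hd).trans ((Finset.sum_le_sum hround).trans ?_)
  rw [← Finset.mul_sum, ← Finset.mul_sum, Finset.sum_comm]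
  gcongr
  simp_rw [Finset.sum_add_distrib]
  calc _ ≤ ENNReal.ofReal (Real.exp (c ^ 2))
        * (∑ _i : Fin m, (ENNReal.ofReal (1 - Real.exp (-c ^ 2)))⁻¹
          + ∑ _i : Fin m, (ENNReal.ofReal (1 - Real.exp (-c ^ 2)))⁻¹) := by
        gcongr with i _ i _
        · exact hsum c (.inl rfl) i
        · exact hsum (-c) (.inr rfl) i
    _ = _ := by
        rw [← ENNReal.ofReal_inv_of_pos hpos, Finset.sum_const, Finset.card_univ,
          Fintype.card_fin, nsmul_eq_mul, ← two_mul, ENNReal.ofReal_mul (by positivity),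
          ENNReal.ofReal_mul (by norm_num), div_eq_mul_inv, ENNReal.ofReal_mul (Real.exp_pos _).le]
        simp only [ENNReal.ofReal_ofNat, ENNReal.ofReal_natCast]
        ring

end Regret

end CommunityExploration

theorem theorem4 (m K T : ℕ) (hK : m < K) (d : Fin m → ℕ) (hd : ∀ i, 1 ≤ d i)
    {Ω : Type*} [MeasurableSpace Ω] (P : Measure Ω) [IsProbabilityMeasure P]
    (Φ : ℕ → Ω → CommunityExploration.Realization d K)
    (k : ℕ → Ω → CommunityExploration.Allocation m)
    (hrun : CommunityExploration.IsRun d K T P Φ k)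
    (kstar : CommunityExploration.Allocation m)
    (hstar : CommunityExploration.IsOptimal d K kstar)
    (K' : ℕ) (hK' : K' = K - m + 1) :
    ((CommunityExploration.regret T P Φ k kstar : ℝ) : EReal) ≤
      (((2 + 2 * (m : ℝ≥0∞) * ENNReal.ofReal (Real.exp 1) ^ 2 * (K' : ℝ≥0∞) ^ 2
            * ((K' - 1 : ℕ) : ℝ≥0∞) ^ 2 / CommunityExploration.gapMin d K kstar ^ 2)
          * CommunityExploration.gapMax d K kstar : ℝ≥0∞) : EReal) := by
  open CommunityExploration in
  have hreal : ((regret T P Φ k kstar : ℝ) : EReal)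
      ≤ ((ENNReal.ofReal (regret T P Φ k kstar) : ℝ≥0∞) : EReal) := by
    rw [EReal.coe_ennreal_ofReal]
    exact_mod_cast le_max_left _ _
  refine hreal.trans (EReal.coe_ennreal_le_coe_ennreal_iff.2 ?_)
  by_cases hall : ∀ t < T, ∀ ω, gap d K kstar (k t ω) ≤ 0
  · refine (hrun.ofReal_regret_le hd).trans (le_of_eq_of_le ?_ zero_le)
    refine Finset.sum_eq_zero fun t ht => ?_
    simp [ENNReal.ofReal_of_nonpos (hall t (Finset.mem_range.1 ht) _)]
  push Not at hall
  obtain ⟨t, ht, ω, hg⟩ := hall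
  have hmax : gapMax d K kstar ≠ 0 :=
    ((ENNReal.ofReal_pos.2 hg).trans_le (le_gapMax hK (hrun.sum_eq ht ω) hg)).ne'
  obtain ⟨i, -, hle⟩ := hrun.exists_gapMin_le hK hd hstar ht hg
  have hm : 0 < m := i.pos
  obtain ⟨a, ha⟩ : ∃ a, K - m = a + 1 := ⟨K - m - 1, by omega⟩
  subst hK'
  rw [Nat.add_sub_cancel]
  -- For a zero least gap the right side is `⊤`: the numerator and `gapMax` are nonzero.
  rcases eq_or_ne (gapMin d K kstar) 0 with h0 | h0
  · have hexp : ENNReal.ofReal (Real.exp 1) ≠ 0 := (ENNReal.ofReal_pos.2 (Real.exp_pos 1)).ne'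
    have : (2 * (m : ℝ≥0∞) * ENNReal.ofReal (Real.exp 1) ^ 2 * ((K - m + 1 : ℕ) : ℝ≥0∞) ^ 2
        * ((K - m : ℕ) : ℝ≥0∞) ^ 2 / gapMin d K kstar ^ 2) = ⊤ := by
      rw [h0, zero_pow two_ne_zero]
      refine ENNReal.div_zero ?_
      simp [hexp, hm.ne', ha]
    rw [this, add_top, ENNReal.top_mul hmax]
    exact le_top
  set A : ℝ := ((K - m + 1 : ℕ) : ℝ) * ((K - m : ℕ) : ℝ) with hA
  have hA0 : 0 < A := by rw [hA, ha]; positivity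
  have hμ0 : 0 ≤ 1 / (d i : ℝ) := by positivity
  have hμ1 := one_sub_inv_nonneg hd i
  have herr : |empMean (fun s => Φ s ω) (fun s => k s ω) t i - 1 / (d i : ℝ)| ≤ 1 := by
    have h1 := empMean_nonneg (fun s => Φ s ω) (fun s => k s ω) t i
    have h2 := empMean_le_one (φ := fun s => Φ s ω) (k := fun s => k s ω) i (t := t)
      fun s hs => hrun.allocation_le (hs.trans ht) ω i
    rw [abs_le]
    constructor <;> linarith
  have hgA : gapMin d K kstar ≤ ENNReal.ofReal A :=
    hle.trans (ENNReal.ofReal_le_ofReal (mul_le_of_le_one_right hA0.le herr))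
  have htop : gapMin d K kstar ≠ ⊤ := (hgA.trans_lt ENNReal.ofReal_lt_top).ne
  obtain ⟨g, hg0, hgeq⟩ : ∃ g : ℝ, 0 < g ∧ gapMin d K kstar = ENNReal.ofReal g :=
    ⟨_, ENNReal.toReal_pos h0 htop, (ENNReal.ofReal_toReal htop).symm⟩
  rw [hgeq, ENNReal.ofReal_le_ofReal_iff hA0.le] at hgA
  -- Chosen so that `2c` is the error `Δ_min / A` forced by a suboptimal round. Errors never exceed
  -- `1`, hence `g ≤ A` and `c ^ 2 ≤ 1/4`.
  set c : ℝ := g / A / 2 with hc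
  have hc0 : 0 < c := by positivity
  have hc1 : c ≤ 1 / 2 := by
    have : g / A ≤ 1 := (div_le_one hA0).2 hgA
    linarith
  have hgc : A * (2 * c) = g := by rw [hc]; field_simp
  have hreg := hrun.ofReal_regret_le_gapMax_mul hK hd hstar hc0 (by linarith)
    (by rw [← hA, hgc, hgeq])
  refine hreg.trans ?_
  rw [mul_comm]
  gcongr
  -- The summand `2` of the bound is slack.
  refine le_add_of_le_right ?_
  have hrhs : 2 * (m : ℝ≥0∞) * ENNReal.ofReal (Real.exp 1) ^ 2 * ((K - m + 1 : ℕ) : ℝ≥0∞) ^ 2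
      * ((K - m : ℕ) : ℝ≥0∞) ^ 2 / gapMin d K kstar ^ 2
      = ENNReal.ofReal (2 * m * Real.exp 1 ^ 2 * ((K - m + 1 : ℕ) : ℝ) ^ 2
        * ((K - m : ℕ) : ℝ) ^ 2 / g ^ 2) := by
    rw [hgeq, ENNReal.ofReal_div_of_pos (by positivity), ENNReal.ofReal_pow hg0.le,
      ENNReal.ofReal_mul (by positivity), ENNReal.ofReal_mul (by positivity),
      ENNReal.ofReal_mul (by positivity), ENNReal.ofReal_mul (by norm_num),
      ENNReal.ofReal_pow (by positivity), ENNReal.ofReal_pow (by positivity),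
      ENNReal.ofReal_pow (by positivity)]
    simp only [ENNReal.ofReal_ofNat, ENNReal.ofReal_natCast]
  rw [hrhs]
  refine ENNReal.ofReal_le_ofReal ?_
  have hconst := exp_div_one_sub_exp_le (x := c ^ 2) (by positivity) (by nlinarith)
  calc 2 * m * (Real.exp (c ^ 2) / (1 - Real.exp (-c ^ 2)))
      ≤ 2 * m * (Real.exp 1 ^ 2 / (4 * c ^ 2)) := by gcongr
    _ = 2 * m * Real.exp 1 ^ 2 * A ^ 2 / g ^ 2 := by rw [hc]; field_simp; norm_num
    _ = _ := by rw [hA]; ring
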